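/- Let $k\ge 2$ be even, let $n\ge k+1$ and $m\ge 0$ be integers, and let $K_n^k$ be the complete $k$-uniform hypergraph on $n$ vertices. The adjacency tensor of a finite $k$-uniform hypergraph $G$ is the tensor of order $k$, indexed by $V(G)$, whose entry at $(v_1,\dots,v_k)$ is $\frac1{(k-1)!}$ if $\{v_1,\dots,v_k\}\in E(G)$ and $0$ otherwise. An H-eigenvalue of $G$ is a real $\lambda$ for which some real vector $x\neq 0$ satisfies $\sum_{v_2,\dots,v_k} a_{v v_2\cdots v_k}x_{v_2}\cdots x_{v_k}=\lambda x_v^{k-1}$ for all $v\in V(G)$, and $\lambda_{\min}(G)$ is the least H-eigenvalue of $G$. A hypertree is a finite connected hypergraph that has no cycle (no cyclic sequence $v_0e_0v_1e_1\cdots v_{l-1}e_{l-1}v_0$, $l\ge2$, of distinct vertices and distinct edges with $v_i,v_{i+1}\in e_i$). Let $\mathcal T_m(K_n^k)$ be the class of all hypergraphs, up to isomorphism, that are obtained from $K_n^k$ by attaching finitely many $k$-uniform hypertrees at vertices of $K_n^k$ (that is, each time identifying one vertex of a hypertree with a vertex of $K_n^k$) and that have exactly $|E(K_n^k)|+m$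 edges. Let $S_m^k$ be the $k$-uniform hyperstar with $m$ edges, i.e. $m$ edges of size $k$ sharing a central vertex and having no other vertex in common, and for a vertex $u$ of $K_n^k$ let $K_n^k(u)\diamond S_m^k(u)$ be the hypergraph obtained from vertex-disjoint copies of $K_n^k$ and $S_m^k$ by identifying $u$ with the central vertex of $S_m^k$. Then every $G\in\mathcal T_m(K_n^k)$ has a least H-eigenvalue, and for every vertex $u$ of $K_n^k$ the hypergraph $K_n^k(u)\diamond S_m^k(u)$ is, up to isomorphism, the unique minimizing hypergraph in $\mathcal T_m(K_n^k)$: a hypergraph $G$ satisfies $G\in\mathcal T_m(K_n^k)$ and $\lambda_{\min}(G)\le\lambda_{\min}(G')$ for all $G'\in\mathcal T_m(K_n^k)$ if and only if $G$ is isomorphic to $K_n^k(u)\diamond S_m^k(u)$. -/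

import Mathlib

open scoped Hypergraph

namespace Hypergraph

variable {α β : Type*}

/-- Two hypergraphs are isomorphic if some bijection between their vertex sets maps the edges of
the one exactly onto the edges of the other. -/
def Isomorphic (G : Hypergraph α) (H : Hypergraph β) : Prop :=
  ∃ φ : V(G) ≃ V(H), ∀ e : Set V(G),
    (Subtype.val '' e ∈ E(G) ↔ Subtype.val '' (φ '' e) ∈ E(H))

/-- `G` is `k`-uniform: every edge has exactly `k` vertices. -/
def IsUniform (k : ℕ) (G : Hypergraph α) : Prop :=
  ∀ e ∈ E(G), e.Finite ∧ e.ncard = k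

/-- `G` has a vertex, and every two vertices of `G` are joined by a walk. -/
def IsConnected (G : Hypergraph α) : Prop :=
  V(G).Nonempty ∧ ∀ u ∈ V(G), ∀ v ∈ V(G), Relation.ReflTransGen G.Adj u v

/-- `G` has no cycle `v₀ e₀ v₁ e₁ … v_{l-1} e_{l-1} v₀` of length `l ≥ 2` with distinct vertices
and distinct edges. (Here the length is `l + 2` and the indices are taken cyclically.) -/
def IsAcyclic (G : Hypergraph α) : Prop :=
  ¬ ∃ (l : ℕ) (v : Fin (l + 2) → α) (e : Fin (l + 2) → Set α),
    Function.Injective v ∧ Function.Injective e ∧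
      ∀ i, e i ∈ E(G) ∧ v i ∈ e i ∧ v (i + 1) ∈ e i

/-- A `k`-uniform hypertree: a finite `k`-uniform hypergraph, connected and acyclic. -/
structure IsHypertree (k : ℕ) (G : Hypergraph α) : Prop where
  finite : V(G).Finite
  uniform : G.IsUniform k
  connected : G.IsConnected
  acyclic : G.IsAcyclic

open Classical in
/-- The map that places the `i`-th attached hypergraph, on the type `W i`, into the disjoint union,
its root `r i` being identified with the vertex `a i` of the base hypergraph. -/
noncomputable def attachMap {ι : Type*} {W : ι → Type*} (a : ι → α) (r : ∀ i, W i) (i : ι)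
    (w : W i) : α ⊕ (Σ i, W i) :=
  if w = r i then Sum.inl (a i) else Sum.inr ⟨i, w⟩

/-- The hypergraph obtained from `G₀` by attaching vertex-disjoint copies of the hypergraphs `T i`,
the vertex `r i` of `T i` being identified with the vertex `a i` of `G₀`. -/
noncomputable def attach (G₀ : Hypergraph α) {ι : Type*} {W : ι → Type*} (a : ι → α)
    (T : ∀ i, Hypergraph (W i)) (r : ∀ i, W i) : Hypergraph (α ⊕ (Σ i, W i)) where
  vertexSet := V(G₀.image Sum.inl) ∪ ⋃ i, V((T i).image (attachMap a r i))
  edgeSet := E(G₀.image Sum.inl) ∪ ⋃ i, E((T i).image (attachMap a r i))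
  subset_vertexSet_of_mem_edgeSet' := by
    rintro e (he | he)
    · exact he.subset_vertexSet.trans Set.subset_union_left
    · obtain ⟨i, hi⟩ := Set.mem_iUnion.1 he
      exact (hi.subset_vertexSet.trans
        (Set.subset_iUnion (fun i => V((T i).image (attachMap a r i))) i)).trans
        Set.subset_union_right

/-- The coalescence `G₁(v₁) ◇ G₂(v₂)`: vertex-disjoint copies of `G₁` and `G₂`, with `v₁`
and `v₂` identified. -/
noncomputable def coalescence (G₁ : Hypergraph α) (v₁ : α) (G₂ : Hypergraph β) (v₂ : β) :
    Hypergraph (α ⊕ (Σ _ : Unit, β)) :=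
  G₁.attach (fun _ : Unit => v₁) (fun _ => G₂) (fun _ => v₂)

/-- The class of all hypergraphs, up to isomorphism, that are obtained from `G₀` by attaching
finitely many `k`-uniform hypertrees at vertices of `G₀` (several may be attached at the same
vertex) and that have exactly `m` edges more than `G₀`. -/
def AttachClass (k m : ℕ) (G₀ : Hypergraph α) (γ : Type) (G : Hypergraph γ) : Prop :=
  (∃ (ι : Type) (_ : Finite ι) (W : ι → Type) (a : ι → α) (T : ∀ i, Hypergraph (W i))
      (r : ∀ i, W i),
      (∀ i, a i ∈ V(G₀)) ∧ (∀ i, (T i).IsHypertree k) ∧ (∀ i, r i ∈ V(T i)) ∧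
        G.Isomorphic (G₀.attach a T r)) ∧
    E(G).ncard = E(G₀).ncard + m

/-- The complete `k`-uniform hypergraph on `n` vertices. -/
def completeUniform (n k : ℕ) : Hypergraph (Fin n) where
  vertexSet := Set.univ
  edgeSet := {e | e.ncard = k}
  subset_vertexSet_of_mem_edgeSet' := fun _ _ => Set.subset_univ _

/-- The `k`-uniform hyperstar with `m` edges. Its central vertex is `none`. The `i`-th edge
consists of the central vertex and the `k - 1` private vertices `some (i, j)`, that is, the `i`-th
leaf of the star and the `k - 2` additional vertices put into the `i`-th edge of the star. -/
def hyperstar (m k : ℕ) : Hypergraph (Option (Fin m × Fin (k - 1))) where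
  vertexSet := Set.univ
  edgeSet := Set.range fun i : Fin m => insert none (Set.range fun j : Fin (k - 1) => some (i, j))
  subset_vertexSet_of_mem_edgeSet' := fun _ _ => Set.subset_univ _

/-- The real number `λ` is an H-eigenvalue of the real tensor `A = (a_{i i₂ … i_k})` of order `k`,
written as a function of its first index `i` and of the tuple `(i₂, …, i_k)` of the other ones:
`∑ a_{i i₂ … i_k} x_{i₂} ⋯ x_{i_k} = λ x_i ^ (k - 1)` for all `i`, for some real `x ≠ 0`. -/
def IsHEigenvalue {I : Type*} [Fintype I] {k : ℕ} (A : I → (Fin (k - 1) → I) → ℝ) (lam : ℝ) :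
    Prop :=
  ∃ x : I → ℝ, x ≠ 0 ∧
    ∀ i, ∑ f : Fin (k - 1) → I, A i f * ∏ j, x (f j) = lam * x i ^ (k - 1)

open Classical in
/-- The adjacency tensor of a `k`-uniform hypergraph, indexed by the vertices: the entry at
`(v₁, …, v_k)` is `1 / (k - 1)!` if `{v₁, …, v_k}` is an edge, and `0` otherwise. -/
noncomputable def adjacencyTensor (k : ℕ) (G : Hypergraph α) (v : V(G))
    (f : Fin (k - 1) → V(G)) : ℝ :=
  if insert (v : α) (Set.range fun j => (f j : α)) ∈ E(G) then 1 / ((k - 1).factorial : ℝ) else 0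

/-- The set of H-eigenvalues of the adjacency tensor of `G`. -/
def hEigenvalues (k : ℕ) (G : Hypergraph α) [Fintype V(G)] : Set ℝ :=
  {lam | IsHEigenvalue (G.adjacencyTensor k) lam}

/-- The least H-eigenvalue of (the adjacency tensor of) `G`. -/
noncomputable def leastHEigenvalue (k : ℕ) (G : Hypergraph α) [Fintype V(G)] : ℝ :=
  sInf (G.hEigenvalues k)

/-- `G` is a minimizing hypergraph in the class `𝒞` of finite `k`-uniform hypergraphs: it belongs
to `𝒞`, and its least H-eigenvalue is the smallest among all members of `𝒞`. -/
def IsMinimizing (k : ℕ) (𝒞 : ∀ γ : Type, Hypergraph γ → Prop) {γ : Type} (G : Hypergraph γ)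
    [Fintype V(G)] : Prop :=
  𝒞 γ G ∧ ∀ (δ : Type) (H : Hypergraph δ) [Fintype V(H)], 𝒞 δ H →
    G.leastHEigenvalue k ≤ H.leastHEigenvalue k

end Hypergraph

/-! Since k is even, the least H-eigenvalue is k times the minimum of F(x) / ∑ x_v ^ k, where F is
the sum over the edges of the products of the coordinates (`sum_adjacencyTensor`,
`isLeast_of_isLeastQuotient`). It therefore suffices to compare these minima.

Let x be a minimizing vector for a member G of the class, let p be a vertex where |x| is largest,
and let b be the base vertex through which the base reaches p. Root the attached hypertrees so that
parents point towards p (`IsHypertree.exists_isRooting`). Every tree edge then consists of a parent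
and k - 1 children, and every vertex except p and the base vertices other than b is a child exactly
once (`exists_attach_eq_image_rootedModel`). Now let p replace b in the complete hypergraph and
become the parent of every tree edge. The result is a coalescence with a hyperstar on the same
number of vertices. F is affine in the value at b inside the base edges and in the value of each
parent, so replacing these values by ±|x_p| with suitable signs does not increase F. Signs are free,
because k-th powers ignore them and flipping one child flips the product over its edge. Hence the
star has the smaller minimum.

In the case of equality the rearranged vector minimizes the quotient for the star. The coefficients
of the replaced values are nonzero there (`elemSymm_erase_ne_zero`, `row_prod_neg`), so b and all
parents had modulus |x_p| already. If there is a star edge, then the center strictly dominates the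
pendant vertices (`row_abs_lt`) and no other base vertex has its modulus (`abs_ne_center`). So b and
all parents were p itself, and G is the star coalescence. The inequality and its equality case are
`energy_nonneg_and_of_eq_zero`. -/

namespace Hypergraph

/-! ### Edge polynomials and the variational description of the least eigenvalue -/

section Forms

open Finset

variable {I : Type*}

/-- The polynomial `∑ e, ∏ v ∈ e, x v` of a finite family of finite edges. -/
noncomputable def edgeForm (E : Finset (Finset I)) (x : I → ℝ) : ℝ := ∑ e ∈ E, ∏ v ∈ e, x v

/-- `ν` is the least value of the quotient of `F` by the `k`-th power sum. -/
def IsLeastQuotient [Fintype I] (k : ℕ) (F : (I → ℝ) → ℝ) (ν : ℝ) : Prop :=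
  (∀ x, ν * ∑ v, x v ^ k ≤ F x) ∧ ∃ x, x ≠ 0 ∧ F x = ν * ∑ v, x v ^ k

lemma sum_pow_pos [Fintype I] {k : ℕ} (hke : Even k) {x : I → ℝ} (hx : x ≠ 0) :
    0 < ∑ v, x v ^ k := by
  obtain ⟨v, hv⟩ := Function.ne_iff.1 hx
  exact sum_pos' (fun i _ => hke.pow_nonneg _) ⟨v, mem_univ _, hke.pow_pos hv⟩

/-- The first order condition for a function that is linear up to a pure power. -/
lemma slope_eq_zero_of_nonneg {k : ℕ} {μ A B C : ℝ} (h : ∀ s, 0 ≤ A + B * s + μ * s ^ k)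
    (h0 : A + B * C + μ * C ^ k = 0) : B + μ * (k * C ^ (k - 1)) = 0 := by
  have hmin : IsLocalMin (fun s : ℝ => A + B * s + μ * s ^ k) C :=
    Filter.Eventually.of_forall fun s => by simpa [h0] using h s
  refine hmin.hasDerivAt_eq_zero ?_
  have h1 : HasDerivAt (fun s : ℝ => A + B * s) B C := by
    simpa using ((hasDerivAt_id C).const_mul B).const_add A
  exact h1.add ((hasDerivAt_pow k C).const_mul μ)

lemma edgeForm_smul {k : ℕ} {E : Finset (Finset I)} (hE : ∀ e ∈ E, e.card = k) (t : ℝ) (x : I → ℝ) :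
    edgeForm E (t • x) = t ^ k * edgeForm E x := by
  simp only [edgeForm, mul_sum, Pi.smul_apply, smul_eq_mul, prod_mul_distrib, prod_const]
  exact sum_congr rfl fun e he => by rw [hE e he]

/-- Numerator and denominator are homogeneous of the same degree, and evenness keeps the denominator
positive off 0. A minimum on the compact unit sphere is thus a global one. -/
lemma exists_isLeastQuotient [Fintype I] [Nonempty I] {k : ℕ} (hk : k ≠ 0) (hke : Even k)
    {E : Finset (Finset I)} (hE : ∀ e ∈ E, e.card = k) :
    ∃ ν, IsLeastQuotient k (edgeForm E) ν := by
  have hcont : Continuous (edgeForm E) := by unfold edgeForm; fun_prop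
  have hpos : ∀ x : I → ℝ, x ∈ Metric.sphere (0 : I → ℝ) 1 → x ≠ 0 := by
    intro x hx h0
    simp [h0] at hx
  have hne : (Metric.sphere (0 : I → ℝ) 1).Nonempty := by
    refine ⟨fun _ => 1, ?_⟩
    simp
  obtain ⟨x, hx, hmin⟩ := (isCompact_sphere (0 : I → ℝ) 1).exists_isMinOn hne
    (f := fun x => edgeForm E x / ∑ v, x v ^ k)
    (hcont.continuousOn.div (by fun_prop) fun x hx => (sum_pow_pos hke (hpos x hx)).ne')
  refine ⟨edgeForm E x / ∑ v, x v ^ k, fun y => ?_, x, hpos x hx, ?_⟩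
  · by_cases hy : y = 0
    · subst hy
      have : ∀ e ∈ E, ∏ v ∈ e, (0 : I → ℝ) v = 0 := fun e he => by
        rw [Pi.zero_def, prod_const, hE e he, zero_pow hk]
      have h0 : edgeForm E 0 = 0 := sum_eq_zero this
      simp [h0, hk]
    · have hy' : 0 < ‖y‖ := norm_pos_iff.2 hy
      have h := hmin (a := ‖y‖⁻¹ • y) (by simp [norm_smul, hy'.ne'])
      simp only [Set.mem_ofPred_eq, edgeForm_smul hE, Pi.smul_apply, smul_eq_mul, mul_pow,
        ← mul_sum] at h
      rw [mul_div_mul_left _ _ (by positivity)] at h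
      exact (le_div_iff₀ (sum_pow_pos hke hy)).1 h
  · field_simp [(sum_pow_pos hke (hpos x hx)).ne']

/-- The partial derivative of `edgeForm E` at the vertex `v`. -/
noncomputable def edgeGrad [DecidableEq I] (E : Finset (Finset I)) (v : I) (x : I → ℝ) : ℝ :=
  ∑ e ∈ E with v ∈ e, ∏ w ∈ e.erase v, x w

lemma edgeForm_update [DecidableEq I] (E : Finset (Finset I)) (v : I) (x : I → ℝ) (s : ℝ) :
    edgeForm E (Function.update x v s) =
      (∑ e ∈ E with v ∉ e, ∏ w ∈ e, x w) + edgeGrad E v x * s := by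
  rw [edgeForm, ← sum_filter_add_sum_filter_not E (v ∈ ·), add_comm, edgeGrad, sum_mul]
  congr 1
  · refine sum_congr rfl fun e he => prod_congr rfl fun w hw => ?_
    rw [Function.update_of_ne]
    rintro rfl
    exact (mem_filter.1 he).2 hw
  · refine sum_congr rfl fun e he => ?_
    rw [prod_update_of_mem (mem_filter.1 he).2, mul_comm, sdiff_singleton_eq_erase]

/-- Euler's identity: the monomial of an edge is counted once for each of its k vertices. -/
lemma sum_mul_edgeGrad [Fintype I] [DecidableEq I] {k : ℕ} {E : Finset (Finset I)}
    (hE : ∀ e ∈ E, e.card = k) (x : I → ℝ) :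
    ∑ v, x v * edgeGrad E v x = k * edgeForm E x := by
  simp only [edgeGrad, mul_sum, sum_filter, edgeForm]
  rw [sum_comm]
  refine sum_congr rfl fun e he => ?_
  have : ∀ v, (if v ∈ e then x v * ∏ w ∈ e.erase v, x w else 0) =
      if v ∈ e then ∏ w ∈ e, x w else 0 := fun v => by
    split_ifs with h
    · rw [mul_prod_erase _ _ h]
    · rfl
  simp [mul_ite, this, hE e he]

lemma sum_update_pow [Fintype I] [DecidableEq I] (k : ℕ) (x : I → ℝ) (v : I) (s : ℝ) :
    ∑ w, Function.update x v s w ^ k = s ^ k + ∑ w ∈ univ.erase v, x w ^ k := by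
  rw [← add_sum_erase _ _ (mem_univ v), Function.update_self]
  congr 1
  exact sum_congr rfl fun w hw => by rw [Function.update_of_ne (ne_of_mem_erase hw)]

/-- An edge contains v at most once, so the form is affine in the coordinate at v. The difference of
the two sides of `h`, as a function of this coordinate alone, is nonnegative with a zero at `x v`,
so its derivative vanishes there. -/
lemma edgeGrad_eq_of_minimizer [Fintype I] [DecidableEq I] {k : ℕ} {E : Finset (Finset I)} {ν : ℝ}
    (h : ∀ x, ν * ∑ v, x v ^ k ≤ edgeForm E x) {x : I → ℝ}
    (hx : edgeForm E x = ν * ∑ v, x v ^ k) (v : I) :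
    edgeGrad E v x = k * ν * x v ^ (k - 1) := by
  have := slope_eq_zero_of_nonneg (k := k) (μ := -ν) (B := edgeGrad E v x) (C := x v)
    (A := (∑ e ∈ E with v ∉ e, ∏ w ∈ e, x w) - ν * ∑ w ∈ univ.erase v, x w ^ k) ?_ ?_
  · linarith
  · intro s
    have := h (Function.update x v s)
    rw [sum_update_pow, edgeForm_update] at this
    linarith
  · have h1 := edgeForm_update E v x (x v)
    have h2 := sum_update_pow k x v (x v)
    rw [Function.update_eq_self] at h1 h2
    rw [h1, h2] at hx
    linarith

/-- A minimizer is an eigenvector by the first order condition. Conversely, Euler's identity shows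
that any eigenvalue is k times the quotient at its eigenvector, hence at least k times the minimum.
-/
lemma isLeast_of_isLeastQuotient [Fintype I] [DecidableEq I] {k : ℕ} (hk : k ≠ 0) (hke : Even k)
    {E : Finset (Finset I)} (hE : ∀ e ∈ E, e.card = k) {ν : ℝ}
    (h : IsLeastQuotient k (edgeForm E) ν) :
    IsLeast {lam | ∃ x : I → ℝ, x ≠ 0 ∧ ∀ v, edgeGrad E v x = lam * x v ^ (k - 1)} (k * ν) := by
  refine ⟨?_, ?_⟩
  · obtain ⟨x, hx0, hx⟩ := h.2
    exact ⟨x, hx0, edgeGrad_eq_of_minimizer h.1 hx⟩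
  · rintro lam ⟨x, hx0, hx⟩
    have h1 := sum_mul_edgeGrad hE x
    have h2 : ∑ v, x v * edgeGrad E v x = lam * ∑ v, x v ^ k := by
      rw [mul_sum]
      refine sum_congr rfl fun v _ => ?_
      rw [hx, mul_left_comm, mul_pow_sub_one hk]
    have h3 := h.1 x
    have h4 := sum_pow_pos hke hx0
    have hk' : (0 : ℝ) < k := by positivity
    refine le_of_mul_le_mul_right ?_ h4
    rw [← h2, h1, mul_assoc]
    gcongr

end Forms

/-! ### From the adjacency tensor to the edge polynomial -/

section Tensor

open Finset

variable {α β : Type*}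

open Classical in
/-- The edges of a hypergraph with finitely many vertices, as finite sets of vertices. -/
noncomputable def edgeFinsets (G : Hypergraph α) [Fintype V(G)] : Finset (Finset V(G)) :=
  {e | Subtype.val '' (e : Set V(G)) ∈ E(G)}

lemma mem_edgeFinsets {G : Hypergraph α} [Fintype V(G)] {e : Finset V(G)} :
    e ∈ G.edgeFinsets ↔ Subtype.val '' (e : Set V(G)) ∈ E(G) := by
  simp [edgeFinsets]

lemma IsUniform.card_eq {k : ℕ} {G : Hypergraph α} [Fintype V(G)] (hG : G.IsUniform k)
    {e : Finset V(G)} (he : e ∈ G.edgeFinsets) : e.card = k := by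
  have := (hG _ (mem_edgeFinsets.1 he)).2
  rwa [Set.ncard_image_of_injective _ Subtype.val_injective, Set.ncard_coe_finset] at this

lemma card_filter_injective_image {I : Type*} [Fintype I] [DecidableEq I] (s : Finset I) {d : ℕ}
    (hs : s.card = d) :
    #{f : Fin d → I | Function.Injective f ∧ univ.image f = s} = d.factorial := by
  classical
  have h : ({f : Fin d → I | Function.Injective f ∧ univ.image f = s} : Finset (Fin d → I)) =
      univ.image fun (σ : Fin d ≃ s) (j : Fin d) => (σ j : I) := by
    ext f
    simp only [mem_filter_univ, mem_image, mem_univ, true_and]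
    constructor
    · rintro ⟨hf, rfl⟩
      refine ⟨Equiv.ofBijective (fun j => ⟨f j, mem_image_of_mem _ (mem_univ j)⟩) ⟨?_, ?_⟩, rfl⟩
      · intro i j hij
        exact hf (congrArg Subtype.val hij)
      · rintro ⟨w, hw⟩
        obtain ⟨j, -, rfl⟩ := mem_image.1 hw
        exact ⟨j, rfl⟩
    · rintro ⟨σ, rfl⟩
      refine ⟨Subtype.val_injective.comp σ.injective, ?_⟩
      ext w
      simp only [mem_image, mem_univ, true_and]
      constructor
      · rintro ⟨j, rfl⟩
        exact (σ j).2
      · intro hw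
        exact ⟨σ.symm ⟨w, hw⟩, by simp⟩
  rw [h, card_image_of_injective, card_univ, Fintype.card_equiv, Fintype.card_fin]
  · exact (Fintype.equivFinOfCardEq (by simpa using hs)).symm
  · intro σ τ hστ
    ext j
    exact congrFun hστ j

-- An edge through v arises from the tuples that enumerate its other k - 1 vertices without
-- repetition. There are (k - 1)! of them, which cancels the weight of the tensor entries.
open Classical in
lemma sum_adjacencyTensor {k : ℕ} {G : Hypergraph α} [Fintype V(G)]
    (hG : G.IsUniform k) (x : V(G) → ℝ) (v : V(G)) :
    ∑ f : Fin (k - 1) → V(G), G.adjacencyTensor k v f * ∏ j, x (f j) =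
      edgeGrad G.edgeFinsets v x := by
  have hmem : ∀ f : Fin (k - 1) → V(G),
      insert (v : α) (Set.range fun j => (f j : α)) ∈ E(G) ↔
        insert v (univ.image f) ∈ G.edgeFinsets := fun f => by
    rw [mem_edgeFinsets]
    simp only [coe_insert, coe_image, coe_univ, Set.image_univ, Set.image_insert_eq,
      ← Set.range_comp, Function.comp_def]
  have h1 : ∀ f : Fin (k - 1) → V(G), G.adjacencyTensor k v f * ∏ j, x (f j) =
      if insert v (univ.image f) ∈ G.edgeFinsets then
        1 / ((k - 1).factorial : ℝ) * ∏ j, x (f j) else 0 := fun f => by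
    rw [adjacencyTensor, hmem, ite_mul, zero_mul]
    split_ifs <;> rfl
  rw [sum_congr rfl fun f _ => h1 f, ← sum_filter, edgeGrad,
    ← sum_fiberwise_of_maps_to (t := G.edgeFinsets.filter (v ∈ ·))
      (g := fun f => insert v (univ.image f))
      (fun f hf => mem_filter.2 ⟨(mem_filter.1 hf).2, mem_insert_self _ _⟩)]
  refine sum_congr rfl fun e he => ?_
  obtain ⟨he, hv⟩ := mem_filter.1 he
  have hcard : (e.erase v).card = k - 1 := by rw [card_erase_of_mem hv, hG.card_eq he]
  have h2 : (({f : Fin (k - 1) → V(G) | insert v (univ.image f) ∈ G.edgeFinsets} :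
      Finset (Fin (k - 1) → V(G))).filter fun f => insert v (univ.image f) = e) =
      ({f : Fin (k - 1) → V(G) | Function.Injective f ∧ univ.image f = e.erase v} :
        Finset (Fin (k - 1) → V(G))) := by
    ext f
    simp only [mem_filter, mem_univ, true_and]
    constructor
    · rintro ⟨-, hf⟩
      have hsub : e.erase v ⊆ univ.image f := by
        rw [← hf]
        exact erase_insert_subset _ _
      have hle : (univ.image f).card ≤ k - 1 := card_image_le.trans (by simp)
      have heq := eq_of_subset_of_card_le hsub (hle.trans hcard.ge)
      refine ⟨?_, heq.symm⟩
      have := (card_image_iff (s := univ) (f := f)).1 (by rw [← heq, hcard]; simp)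
      exact fun i j hij => this (by simp) (by simp) hij
    · rintro ⟨-, hf⟩
      rw [hf, insert_erase hv]
      exact ⟨he, rfl⟩
  rw [h2]
  have h3 : ∀ f ∈ ({f : Fin (k - 1) → V(G) | Function.Injective f ∧ univ.image f = e.erase v} :
      Finset (Fin (k - 1) → V(G))), 1 / ((k - 1).factorial : ℝ) * ∏ j, x (f j) =
        1 / ((k - 1).factorial : ℝ) * ∏ w ∈ e.erase v, x w := fun f hf => by
    obtain ⟨hf, hf'⟩ := (mem_filter.1 hf).2
    rw [← hf', prod_image hf.injOn]
  rw [sum_congr rfl h3, sum_const, card_filter_injective_image _ hcard, nsmul_eq_mul]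
  have : ((k - 1).factorial : ℝ) ≠ 0 := by positivity
  field_simp

lemma IsUniform.exists_isLeast {k : ℕ} (hk : k ≠ 0) (hke : Even k) {G : Hypergraph α}
    [Fintype V(G)] (hG : G.IsUniform k) (hne : V(G).Nonempty) :
    ∃ ν, IsLeastQuotient k (edgeForm G.edgeFinsets) ν ∧ IsLeast (G.hEigenvalues k) (k * ν) := by
  classical
  have := hne.to_subtype
  obtain ⟨ν, hν⟩ := exists_isLeastQuotient hk hke (E := G.edgeFinsets) fun e he => hG.card_eq he
  refine ⟨ν, hν, ?_⟩
  have := isLeast_of_isLeastQuotient hk hke (fun e he => hG.card_eq he) hν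
  convert this using 1
  ext lam
  simp only [hEigenvalues, IsHEigenvalue, Set.mem_ofPred_eq, sum_adjacencyTensor hG]

lemma IsUniform.isLeast_leastHEigenvalue {k : ℕ} (hk : k ≠ 0) (hke : Even k) {G : Hypergraph α}
    [Fintype V(G)] (hG : G.IsUniform k) (hne : V(G).Nonempty) :
    IsLeast (G.hEigenvalues k) (G.leastHEigenvalue k) := by
  obtain ⟨ν, -, hν⟩ := hG.exists_isLeast hk hke hne
  rwa [leastHEigenvalue, hν.csInf_eq]

lemma IsUniform.isLeastQuotient {k : ℕ} (hk : k ≠ 0) (hke : Even k) {G : Hypergraph α}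
    [Fintype V(G)] (hG : G.IsUniform k) (hne : V(G).Nonempty) :
    IsLeastQuotient k (edgeForm G.edgeFinsets) (G.leastHEigenvalue k / k) := by
  obtain ⟨ν, h, hν⟩ := hG.exists_isLeast hk hke hne
  rw [leastHEigenvalue, hν.csInf_eq]
  have : (k : ℝ) ≠ 0 := by positivity
  rwa [mul_div_cancel_left₀ _ this]

end Tensor

/-! ### The energy on a complete hypergraph with a hyperstar attached -/

section StarEnergy

open Finset Function

variable {ι J L : Type*} [Fintype ι] [DecidableEq ι] [Fintype J] [Fintype L]

/-- The elementary symmetric polynomial of degree `d` in the variables `z b`, `b ∈ S`. -/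
noncomputable def elemSymm (S : Finset ι) (d : ℕ) (z : ι → ℝ) : ℝ :=
  ∑ s ∈ powersetCard d S, ∏ b ∈ s, z b

omit [Fintype ι] [DecidableEq ι] in
lemma elemSymm_congr {S : Finset ι} (d : ℕ) {z z' : ι → ℝ} (h : ∀ b ∈ S, z b = z' b) :
    elemSymm S d z = elemSymm S d z' :=
  sum_congr rfl fun _ hs => prod_congr rfl fun b hb => h b ((mem_powersetCard.1 hs).1 hb)

omit [Fintype ι] in
lemma elemSymm_succ {S : Finset ι} {a : ι} (ha : a ∈ S) (d : ℕ) (z : ι → ℝ) :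
    elemSymm S (d + 1) z = z a * elemSymm (S.erase a) d z + elemSymm (S.erase a) (d + 1) z := by
  have ha' : a ∉ S.erase a := notMem_erase a S
  conv_lhs => rw [← insert_erase ha]
  rw [elemSymm, powersetCard_succ_insert ha', sum_union, sum_image, add_comm, elemSymm, elemSymm,
    mul_sum]
  · congr 1
    refine sum_congr rfl fun s hs => prod_insert fun h => ha' ((mem_powersetCard.1 hs).1 h)
  · intro s hs t ht hst
    have hs' : a ∉ s := fun h => ha' ((mem_powersetCard.1 hs).1 h)
    have ht' : a ∉ t := fun h => ha' ((mem_powersetCard.1 ht).1 h)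
    rw [← erase_insert hs', ← erase_insert ht']
    exact congrArg (fun s => s.erase a) hst
  · rw [disjoint_left]
    intro s hs hs'
    obtain ⟨t, -, rfl⟩ := mem_image.1 hs'
    exact ha' ((mem_powersetCard.1 hs).1 (mem_insert_self a t))

lemma elemSymm_update (a : ι) (d : ℕ) (z : ι → ℝ) (s : ℝ) :
    elemSymm univ (d + 1) (update z a s) =
      s * elemSymm (univ.erase a) d z + elemSymm (univ.erase a) (d + 1) z := by
  have h : ∀ b ∈ univ.erase a, update z a s b = z b := fun b hb =>
    update_of_ne (ne_of_mem_erase hb) _ _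
  rw [elemSymm_succ (mem_univ a), update_self, elemSymm_congr _ h, elemSymm_congr _ h]

/-- The energy of a vector on the coalescence of a complete uniform hypergraph on `ι` with the
hyperstar whose edges are indexed by `J`, attached at `a`. -/
noncomputable def starEnergy (d : ℕ) (μ : ℝ) (a : ι) (z : ι → ℝ) (c : J → L → ℝ) : ℝ :=
  elemSymm univ (d + 1) z + z a * ∑ j, ∏ l, c j l +
    μ * (∑ b, z b ^ (d + 1) + ∑ j, ∑ l, c j l ^ (d + 1))

lemma starEnergy_update_center (d : ℕ) (μ : ℝ) (a : ι) (z : ι → ℝ) (c : J → L → ℝ) (s : ℝ) :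
    starEnergy d μ a (update z a s) c =
      (elemSymm (univ.erase a) (d + 1) z +
        μ * (∑ b ∈ univ.erase a, z b ^ (d + 1) + ∑ j, ∑ l, c j l ^ (d + 1))) +
      (elemSymm (univ.erase a) d z + ∑ j, ∏ l, c j l) * s + μ * s ^ (d + 1) := by
  rw [starEnergy, elemSymm_update, sum_update_pow, update_self]
  ring

lemma starEnergy_update_other (d : ℕ) (μ : ℝ) {a b : ι} (hab : b ≠ a) (z : ι → ℝ) (c : J → L → ℝ)
    (s : ℝ) :
    starEnergy d μ a (update z b s) c =
      (elemSymm (univ.erase b) (d + 1) z + z a * ∑ j, ∏ l, c j l +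
        μ * (∑ b ∈ univ.erase b, z b ^ (d + 1) + ∑ j, ∑ l, c j l ^ (d + 1))) +
      elemSymm (univ.erase b) d z * s + μ * s ^ (d + 1) := by
  rw [starEnergy, elemSymm_update, sum_update_pow, update_of_ne hab.symm]
  ring

omit [DecidableEq ι] in
lemma starEnergy_update_row [DecidableEq J] (d : ℕ) (μ : ℝ) (a : ι) (z : ι → ℝ) (c : J → L → ℝ)
    (j : J) (r : L → ℝ) :
    starEnergy d μ a z (update c j r) =
      starEnergy d μ a z c - (z a * ∏ l, c j l + μ * ∑ l, c j l ^ (d + 1)) +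
        (z a * ∏ l, r l + μ * ∑ l, r l ^ (d + 1)) := by
  have h1 : ∑ i, ∏ l, update c j r i l = ∏ l, r l + ∑ i ∈ univ.erase j, ∏ l, c i l := by
    rw [← add_sum_erase _ _ (mem_univ j), update_self]
    congr 1
    exact sum_congr rfl fun i hi => by rw [update_of_ne (ne_of_mem_erase hi)]
  have h2 : ∑ i, ∑ l, update c j r i l ^ (d + 1) =
      ∑ l, r l ^ (d + 1) + ∑ i ∈ univ.erase j, ∑ l, c i l ^ (d + 1) := by
    rw [← add_sum_erase _ _ (mem_univ j), update_self]
    congr 1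
    exact sum_congr rfl fun i hi => by rw [update_of_ne (ne_of_mem_erase hi)]
  simp only [starEnergy]
  rw [h1, h2, ← add_sum_erase _ (fun i => ∏ l, c i l) (mem_univ j),
    ← add_sum_erase _ (fun i => ∑ l, c i l ^ (d + 1)) (mem_univ j)]
  ring

/-- A vector of constant modulus `s` whose product has a prescribed sign. -/
lemma exists_row_of_sign [Nonempty L] {d : ℕ} (hde : Even (d + 1))
    (t : ℝ) {w : L → ℝ} :
    ∃ r : L → ℝ, (∀ l, |r l| = |w l|) ∧ (∑ l, r l ^ (d + 1) = ∑ l, w l ^ (d + 1)) ∧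
      t * ∏ l, r l = -(|t| * ∏ l, |w l|) := by
  classical
  obtain ⟨l₀⟩ := ‹Nonempty L›
  have key : ∀ ε : ℝ, |ε| = 1 → t * ε = -|t| →
      ∃ r : L → ℝ, (∀ l, |r l| = |w l|) ∧ (∑ l, r l ^ (d + 1) = ∑ l, w l ^ (d + 1)) ∧
        t * ∏ l, r l = -(|t| * ∏ l, |w l|) := by
    intro ε hε ht
    have habs : ∀ l, |update (fun l => |w l|) l₀ (ε * |w l₀|) l| = |w l| := by
      intro l
      by_cases h : l = l₀
      · subst h
        simp [abs_mul, hε]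
      · rw [update_of_ne h, abs_abs]
    refine ⟨update (fun l => |w l|) l₀ (ε * |w l₀|), habs, ?_, ?_⟩
    · refine sum_congr rfl fun l _ => ?_
      rw [← hde.pow_abs, habs, hde.pow_abs]
    · rw [prod_update_of_mem (mem_univ l₀), sdiff_singleton_eq_erase,
        ← mul_prod_erase univ (fun l => |w l|) (mem_univ l₀)]
      linear_combination (|w l₀| * ∏ l ∈ univ.erase l₀, |w l|) * ht
  rcases le_total 0 t with h | h
  · exact key (-1) (by simp) (by rw [abs_of_nonneg h]; ring)
  · exact key 1 (by simp) (by rw [abs_of_nonpos h]; ring)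

/-- Some row of constant modulus makes the minimized expression negative. As the power sum is
nonnegative, the product term of a minimal row has to be negative. -/
lemma row_prod_neg [Nonempty L] {d : ℕ} (hd : Fintype.card L = d) (hde : Even (d + 1))
    {μ t : ℝ} (hμ : 0 < μ) (ht : t ≠ 0) {w : L → ℝ}
    (hw : ∀ r : L → ℝ, t * ∏ l, w l + μ * ∑ l, w l ^ (d + 1) ≤
      t * ∏ l, r l + μ * ∑ l, r l ^ (d + 1)) : t * ∏ l, w l < 0 := by
  have ht' : 0 < |t| := abs_pos.2 ht
  -- With this modulus the value -|t| s^d + μ d s^(d+1) equals -μ s^(d+1).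
  set s : ℝ := |t| / (μ * (d + 1)) with hs
  have hs0 : 0 < s := by positivity
  obtain ⟨r, -, h2, h3⟩ := exists_row_of_sign hde t (w := fun _ : L => s)
  have h := hw r
  rw [h2, h3] at h
  simp only [sum_const, prod_const, card_univ, hd, abs_of_pos hs0, nsmul_eq_mul] at h
  have h4 : 0 ≤ μ * ∑ l, w l ^ (d + 1) :=
    mul_nonneg hμ.le (sum_nonneg fun l _ => hde.pow_nonneg _)
  have h5 : -(|t| * s ^ d) + μ * (d * s ^ (d + 1)) = -(s ^ d * (μ * s)) := by
    have : |t| = s * (μ * (d + 1)) := by rw [hs]; field_simp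
    rw [this]
    ring
  have : 0 < s ^ d * (μ * s) := by positivity
  linarith

/-- The first order condition at the entry of largest modulus M reads (d + 1) μ M^d = |t| times the
product of the other moduli, which is at most |t| M^(d-1). So (d + 1) μ M ≤ |t|, and `hμ` makes this
strict. -/
lemma row_abs_lt [Nonempty L] {d : ℕ} (hd : Fintype.card L = d) (hde : Even (d + 1))
    {μ t : ℝ} (hμ : 1 < (d + 1) * μ) (ht : t ≠ 0) {w : L → ℝ}
    (hw : ∀ r : L → ℝ, t * ∏ l, w l + μ * ∑ l, w l ^ (d + 1) ≤
      t * ∏ l, r l + μ * ∑ l, r l ^ (d + 1)) (l : L) : |w l| < |t| := by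
  classical
  have hμ0 : 0 < μ := by
    by_contra! h
    nlinarith [(Nat.cast_nonneg d : (0 : ℝ) ≤ d)]
  have hneg := row_prod_neg hd hde hμ0 ht hw
  obtain ⟨i, hi⟩ := Finite.exists_max fun l => |w l|
  refine (hi l).trans_lt ?_
  have hwi : w i ≠ 0 := fun h => by
    rw [prod_eq_zero (mem_univ i) h, mul_zero] at hneg
    exact lt_irrefl _ hneg
  have hprod : ∀ s, ∏ l, update w i s l = s * ∏ l ∈ univ.erase i, w l := fun s => by
    rw [prod_update_of_mem (mem_univ i), sdiff_singleton_eq_erase]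
  have h1 := slope_eq_zero_of_nonneg (k := d + 1) (μ := μ) (B := t * ∏ l ∈ univ.erase i, w l)
    (C := w i) (A := -(t * ∏ l, w l) - μ * w i ^ (d + 1)) ?_ ?_
  · have h2 : (d + 1) * μ * |w i| ^ d = |t| * ∏ l ∈ univ.erase i, |w l| := by
      have : (d + 1) * μ * w i ^ d = -(t * ∏ l ∈ univ.erase i, w l) := by
        push_cast at h1
        linarith
      have h3 := congrArg abs this
      rw [abs_neg, abs_mul, abs_mul t, abs_pow, Finset.abs_prod,
        abs_of_pos (by positivity : 0 < (d + 1) * μ)] at h3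
      exact h3
    have h3 : ∏ l ∈ univ.erase i, |w l| ≤ |w i| ^ (d - 1) := by
      refine (prod_le_prod (fun l _ => abs_nonneg _) fun l _ => hi l).trans ?_
      rw [prod_const, card_erase_of_mem (mem_univ i), card_univ, hd]
    have hd0 : d ≠ 0 := by
      rw [← hd]
      exact Fintype.card_ne_zero
    have h4 : 0 < |w i| := abs_pos.2 hwi
    have h5 : (d + 1) * μ * |w i| ≤ |t| := by
      refine le_of_mul_le_mul_right ?_ (pow_pos h4 (d - 1))
      rw [mul_assoc, mul_pow_sub_one hd0, h2]
      gcongr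
    nlinarith
  · intro s
    have h2 := hw (update w i s)
    rw [hprod, sum_update_pow, ← add_sum_erase univ (fun l => w l ^ (d + 1)) (mem_univ i)] at h2
    linarith
  · rw [← mul_prod_erase univ w (mem_univ i)]
    ring

/-- A vector supported on `insert a B`. -/
lemma starEnergy_test {d : ℕ} {a : ι} {B : Finset ι} (ha : a ∉ B) (hB : B.card = d) (μ t ε : ℝ)
    (c : J → L → ℝ) :
    starEnergy d μ a (update (fun b => if b ∈ B then ε else 0) a t) c =
      t * ε ^ d + t * ∑ j, ∏ l, c j l +
        μ * (t ^ (d + 1) + d * ε ^ (d + 1) + ∑ j, ∑ l, c j l ^ (d + 1)) := by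
  have hBa : B ⊆ univ.erase a := fun b hb => mem_erase.2 ⟨fun h => ha (h ▸ hb), mem_univ b⟩
  have hzero : ∀ s : Finset ι, ¬ s ⊆ B → ∏ b ∈ s, (if b ∈ B then ε else 0) = 0 := by
    intro s hs
    obtain ⟨b, hb, hb'⟩ := not_subset.1 hs
    exact prod_eq_zero hb (if_neg hb')
  have h1 : elemSymm (univ.erase a) d (fun b => if b ∈ B then ε else 0) = ε ^ d := by
    rw [elemSymm, sum_eq_single B]
    · rw [prod_congr rfl fun b hb => if_pos hb, prod_const, hB]
    · intro s hs hsB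
      refine hzero s fun h => hsB (eq_of_subset_of_card_le h ?_)
      rw [hB, (mem_powersetCard.1 hs).2]
    · intro h
      exact absurd (mem_powersetCard.2 ⟨hBa, hB⟩) h
  have h2 : elemSymm (univ.erase a) (d + 1) (fun b => if b ∈ B then ε else 0) = 0 := by
    refine sum_eq_zero fun s hs => hzero s fun h => ?_
    have := card_le_card h
    rw [hB, (mem_powersetCard.1 hs).2] at this
    omega
  have h3 : ∑ b ∈ univ.erase a, (if b ∈ B then ε else 0) ^ (d + 1) = d * ε ^ (d + 1) := by
    have : ∀ b, (if b ∈ B then ε else 0) ^ (d + 1) = if b ∈ B then ε ^ (d + 1) else 0 := by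
      intro b
      split_ifs <;> simp
    rw [sum_congr rfl fun b _ => this b, ← sum_filter, filter_mem_eq_inter,
      inter_eq_right.2 hBa, sum_const, hB, nsmul_eq_mul]
  rw [starEnergy_update_center, h1, h2, h3]
  ring

/-! ### Zeros of a nonnegative star energy -/

section Minimal

variable {d : ℕ} {μ : ℝ} {a : ι}

/-- Testing on one base edge through the center, with -1 there and 1 elsewhere on the edge, gives -1
+ μ (d + 1) ≥ 0. -/
lemma pos_of_starEnergy_nonneg [Nonempty L] (hde : Even (d + 1))
    (hn : d + 1 ≤ Fintype.card ι) (h : ∀ (z : ι → ℝ) (c : J → L → ℝ), 0 ≤ starEnergy d μ a z c) :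
    0 < μ := by
  obtain ⟨B, hB, hBd⟩ := exists_subset_card_eq (s := univ.erase a) (n := d)
    (by rw [card_erase_of_mem (mem_univ a), card_univ]; omega)
  have := h (update (fun b => if b ∈ B then 1 else 0) a (-1)) 0
  rw [starEnergy_test (fun ha => notMem_erase a _ (hB ha)) hBd] at this
  simp [hde.neg_one_pow] at this
  by_contra! h
  nlinarith [(Nat.cast_nonneg d : (0 : ℝ) ≤ d)]

/-- Testing on one base edge and one star edge together, with -1 at their common vertex and 1 at the
others, gives (2d + 1) μ ≥ 2, which beats the bound from a single edge. -/
lemma one_lt_mul_of_starEnergy_nonneg [Nonempty L] [Nonempty J] (hd : Fintype.card L = d)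
    (hde : Even (d + 1)) (hn : d + 1 ≤ Fintype.card ι)
    (h : ∀ (z : ι → ℝ) (c : J → L → ℝ), 0 ≤ starEnergy d μ a z c) : 1 < (d + 1) * μ := by
  classical
  obtain ⟨B, hB, hBd⟩ := exists_subset_card_eq (s := univ.erase a) (n := d)
    (by rw [card_erase_of_mem (mem_univ a), card_univ]; omega)
  obtain ⟨j₀⟩ := ‹Nonempty J›
  have := h (update (fun b => if b ∈ B then 1 else 0) a (-1)) (fun j _ => if j = j₀ then 1 else 0)
  rw [starEnergy_test (fun ha => notMem_erase a _ (hB ha)) hBd] at this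
  have hd0 : d ≠ 0 := by
    rw [← hd]
    exact Fintype.card_ne_zero
  simp [hde.neg_one_pow, ite_pow, hd, hd0] at this
  have hd1 : (1 : ℝ) ≤ d := by exact_mod_cast Nat.one_le_iff_ne_zero.2 hd0
  by_contra! h
  nlinarith

variable (h : ∀ (z : ι → ℝ) (c : J → L → ℝ), 0 ≤ starEnergy d μ a z c)
  {z : ι → ℝ} {c : J → L → ℝ} (h0 : starEnergy d μ a z c = 0)

include h h0

omit [DecidableEq ι] in
lemma row_minimal (j : J) (r : L → ℝ) : z a * ∏ l, c j l + μ * ∑ l, c j l ^ (d + 1) ≤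
      z a * ∏ l, r l + μ * ∑ l, r l ^ (d + 1) := by
  classical
  have := h z (update c j r)
  rw [starEnergy_update_row, h0] at this
  linarith

/-- If the coefficient of the center vanished, the energy would split into a part of the other base
vertices, which is nonnegative by itself, and a part of the center and the rows, which would then be
at most 0. Replacing the other base values by suitable values on a single edge through the center
would make the energy negative. -/
lemma elemSymm_erase_ne_zero [Nonempty L] (hd : Fintype.card L = d) (hde : Even (d + 1))
    (hn : d + 1 ≤ Fintype.card ι) (hz : z a ≠ 0) : elemSymm (univ.erase a) d z ≠ 0 := by
  intro hP
  have hμ := pos_of_starEnergy_nonneg hde hn h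
  have hd0 : d ≠ 0 := by
    rw [← hd]
    exact Fintype.card_ne_zero
  obtain ⟨B, hB, hBd⟩ := exists_subset_card_eq (s := univ.erase a) (n := d)
    (by rw [card_erase_of_mem (mem_univ a), card_univ]; omega)
  have haB : a ∉ B := fun ha => notMem_erase a _ (hB ha)
  have hbase := h (update z a 0) 0
  rw [starEnergy_update_center] at hbase
  have h1 := starEnergy_update_center d μ a z c (z a)
  rw [update_eq_self, h0, hP] at h1
  simp only [Pi.zero_apply, prod_const, card_univ, hd, zero_pow hd0, ne_eq, Nat.succ_ne_zero,
    not_false_eq_true, zero_pow, sum_const_zero, add_zero, mul_zero] at hbase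
  -- Here ε will be given the sign opposite to `z a`; as d is odd, ε ^ d has that sign too.
  have key : ∀ ε : ℝ, z a * ε ^ d = -|z a * ε ^ d| → 0 ≤ -|z a * ε ^ d| + μ * (d * ε ^ (d + 1)) := by
    intro ε hε
    have h2 := h (update (fun b => if b ∈ B then ε else 0) a (z a)) c
    rw [starEnergy_test haB hBd, hε] at h2
    linarith
  have hza : 0 < |z a| := abs_pos.2 hz
  set s : ℝ := |z a| / (μ * (d + 1)) with hs
  have hs0 : 0 < s := by positivity
  have hodd : Odd d := by
    rcases Nat.even_or_odd d with h' | h'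
    · exact absurd hde (by simpa using h'.add_one)
    · exact h'
  have hcon : 0 ≤ -(|z a| * s ^ d) + μ * (d * s ^ (d + 1)) := by
    rcases le_total 0 (z a) with hp | hp
    · have := key (-s) (by
        rw [hodd.neg_pow, abs_of_nonpos (by
          have : 0 ≤ z a * s ^ d := by positivity
          linarith)]
        ring)
      rw [hodd.neg_pow, hde.neg_pow, mul_neg, abs_neg, abs_mul, abs_of_pos (pow_pos hs0 d)] at this
      exact this
    · have := key s (by
        rw [abs_of_nonpos (mul_nonpos_of_nonpos_of_nonneg hp (by positivity))]
        ring)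
      rwa [abs_mul, abs_of_pos (pow_pos hs0 d)] at this
  have h5 : -(|z a| * s ^ d) + μ * (d * s ^ (d + 1)) = -(s ^ d * (μ * s)) := by
    have : |z a| = s * (μ * (d + 1)) := by rw [hs]; field_simp
    rw [this]
    ring
  have : 0 < s ^ d * (μ * s) := by positivity
  linarith

lemma center_slope :
    elemSymm (univ.erase a) d z + ∑ j, ∏ l, c j l + μ * ((d + 1) * z a ^ d) = 0 := by
  have := slope_eq_zero_of_nonneg (k := d + 1) (μ := μ) (C := z a)
    (B := elemSymm (univ.erase a) d z + ∑ j, ∏ l, c j l)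
    (fun s => by
      have := h (update z a s) c
      rwa [starEnergy_update_center] at this)
    (by
      have := starEnergy_update_center d μ a z c (z a)
      rw [update_eq_self, h0] at this
      exact this.symm)
  simpa using this

lemma other_slope {b : ι} (hb : b ≠ a) :
    elemSymm (univ.erase b) d z + μ * ((d + 1) * z b ^ d) = 0 := by
  have := slope_eq_zero_of_nonneg (k := d + 1) (μ := μ) (C := z b)
    (B := elemSymm (univ.erase b) d z)
    (fun s => by
      have := h (update z b s) c
      rwa [starEnergy_update_other d μ hb] at this)
    (by
      have := starEnergy_update_other d μ hb z c (z b)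
      rw [update_eq_self, h0] at this
      exact this.symm)
  simpa using this

/-- Add the first order conditions at a and b. Since d is odd, the pure powers cancel for opposite
values, and so do the terms that contain one of the two values as a factor. -/
lemma two_mul_elemSymm_add_eq_zero {b : ι} (hd0 : d ≠ 0) (hde : Even (d + 1)) (hb : b ≠ a)
    (hab : z b = -z a) :
    2 * elemSymm ((univ.erase a).erase b) d z + ∑ j, ∏ l, c j l = 0 := by
  obtain ⟨e, rfl⟩ := Nat.exists_eq_succ_of_ne_zero hd0
  have h1 := center_slope h h0
  have h2 := other_slope h h0 hb
  have hodd : Odd (e + 1) := by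
    rcases Nat.even_or_odd (e + 1) with h' | h'
    · exact absurd hde (by simpa using h'.add_one)
    · exact h'
  simp only [Nat.succ_eq_add_one] at *
  rw [elemSymm_succ (mem_erase.2 ⟨hb, mem_univ b⟩)] at h1
  rw [elemSymm_succ (mem_erase.2 ⟨hb.symm, mem_univ a⟩), erase_right_comm] at h2
  rw [hab] at h1 h2
  rw [hodd.neg_pow] at h2
  linarith

/-- Let X be the sum of the row products; it is nonzero. If `z b = z a`, the first order conditions
at a and b differ only by X, which forces X = 0. If `z b = -z a`, negating both values and one entry
of every row yields another zero of the energy, with -X in place of X. The identity 2Q + X = 0 of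
`two_mul_elemSymm_add_eq_zero` then holds for both signs of X, and again X = 0. -/
lemma abs_ne_center [Nonempty L] [Nonempty J] (hd : Fintype.card L = d) (hde : Even (d + 1))
    (hn : d + 1 ≤ Fintype.card ι) (hz : z a ≠ 0) {b : ι} (hb : b ≠ a) : |z b| ≠ |z a| := by
  classical
  intro habs
  have hμ := pos_of_starEnergy_nonneg hde hn h
  have hd0 : d ≠ 0 := by
    rw [← hd]
    exact Fintype.card_ne_zero
  have hX : z a * ∑ j, ∏ l, c j l < 0 := by
    rw [mul_sum]
    exact sum_neg (fun j _ => row_prod_neg hd hde hμ hz (row_minimal h h0 j)) univ_nonempty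
  have hX0 : ∑ j, ∏ l, c j l ≠ 0 := fun h' => by simp [h'] at hX
  rcases abs_eq_abs.1 habs with hab | hab
  · obtain ⟨e, rfl⟩ := Nat.exists_eq_succ_of_ne_zero hd0
    have h1 := center_slope h h0
    have h2 := other_slope h h0 hb
    simp only [Nat.succ_eq_add_one] at *
    rw [elemSymm_succ (mem_erase.2 ⟨hb, mem_univ b⟩)] at h1
    rw [elemSymm_succ (mem_erase.2 ⟨hb.symm, mem_univ a⟩), erase_right_comm] at h2
    rw [hab] at h1 h2
    exact hX0 (by linarith)
  · have h1 := two_mul_elemSymm_add_eq_zero h h0 hd0 hde hb hab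
    obtain ⟨l₀⟩ := ‹Nonempty L›
    set z' := update (update z a (-z a)) b (-z b) with hz'
    set c' : J → L → ℝ := fun j => update (c j) l₀ (-c j l₀) with hc'
    have hprod : ∀ j, ∏ l, c' j l = -∏ l, c j l := fun j => by
      rw [hc', prod_update_of_mem (mem_univ l₀), sdiff_singleton_eq_erase,
        ← mul_prod_erase univ (c j) (mem_univ l₀)]
      ring
    have hsum : ∀ j, ∑ l, c' j l ^ (d + 1) = ∑ l, c j l ^ (d + 1) := fun j => by
      rw [hc', sum_update_pow, ← add_sum_erase univ (fun l => c j l ^ (d + 1)) (mem_univ l₀),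
        hde.neg_pow]
    have hza : z' a = -z a := by rw [hz', update_of_ne hb.symm, update_self]
    have hzb : z' b = -z b := by rw [hz', update_self]
    have hzo : ∀ i ∈ (univ.erase a).erase b, z' i = z i := fun i hi => by
      rw [hz', update_of_ne (ne_of_mem_erase hi),
        update_of_ne (ne_of_mem_erase (mem_of_mem_erase hi))]
    -- Negating both `y a` and `y b` preserves their product, and the middle term vanishes because
    -- their sum is 0.
    have hexp : ∀ y : ι → ℝ, elemSymm univ (d + 1) y =
        y a * y b * elemSymm ((univ.erase a).erase b) (d - 1) y +
          (y a + y b) * elemSymm ((univ.erase a).erase b) d y +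
          elemSymm ((univ.erase a).erase b) (d + 1) y := fun y => by
      obtain ⟨e, rfl⟩ := Nat.exists_eq_succ_of_ne_zero hd0
      rw [elemSymm_succ (mem_univ a), Nat.succ_eq_add_one,
        elemSymm_succ (mem_erase.2 ⟨hb, mem_univ b⟩) e,
        elemSymm_succ (mem_erase.2 ⟨hb, mem_univ b⟩) (e + 1), Nat.add_sub_cancel]
      ring
    have hpow : ∑ i, z' i ^ (d + 1) = ∑ i, z i ^ (d + 1) := by
      refine sum_congr rfl fun i _ => ?_
      by_cases hib : i = b
      · rw [hib, hzb, hde.neg_pow]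
      · by_cases hia : i = a
        · rw [hia, hza, hde.neg_pow]
        · rw [hzo i (by simp [hia, hib])]
    have h0' : starEnergy d μ a z' c' = 0 := by
      rw [← h0, starEnergy, starEnergy, hexp z', hexp z, hpow, hza, hzb, elemSymm_congr _ hzo,
        elemSymm_congr _ hzo, elemSymm_congr _ hzo, hab]
      simp only [hprod, hsum, sum_neg_distrib]
      ring
    have h2 := two_mul_elemSymm_add_eq_zero h h0' hd0 hde hb (by rw [hza, hzb, hab])
    rw [elemSymm_congr _ hzo] at h2
    simp only [hprod, sum_neg_distrib] at h2
    exact hX0 (by linarith)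

end Minimal

/-- Comparison of the energy of a vector on a hypergraph obtained from a complete uniform hypergraph
by attaching hypertrees, rooted at a vertex of maximal modulus, with that of a vector on the
coalescence with a hyperstar. -/
lemma energy_nonneg_and_of_eq_zero [Nonempty L] {d : ℕ} {μ : ℝ} {a : ι}
    (hd : Fintype.card L = d) (hde : Even (d + 1)) (hn : d + 1 ≤ Fintype.card ι)
    (h : ∀ (z : ι → ℝ) (c : J → L → ℝ), 0 ≤ starEnergy d μ a z c)
    {z : ι → ℝ} {c : J → L → ℝ} {v : ℝ} {q : J → ℝ} (hv : |v| ≤ |z a|) (hq : ∀ j, |q j| ≤ |z a|)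
    {W : ℝ} (hW : W = v * elemSymm (univ.erase a) d z + elemSymm (univ.erase a) (d + 1) z +
      ∑ j, q j * ∏ l, c j l + μ * (∑ b, z b ^ (d + 1) + ∑ j, ∑ l, c j l ^ (d + 1))) :
    0 ≤ W ∧ (W = 0 → z a ≠ 0 → |v| = |z a| ∧ (∀ j, |q j| = |z a|) ∧
      (Nonempty J → (∀ j l, |c j l| < |z a|) ∧ ∀ b, b ≠ a → |z b| ≠ |z a|)) := by
  set P := elemSymm (univ.erase a) d z with hP
  -- The base edges dictate the sign of the new center; the rows are re-signed afterwards to fit it.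
  obtain ⟨t, ht, htP⟩ : ∃ t : ℝ, |t| = |z a| ∧ t * P = -(|z a| * |P|) := by
    rcases le_total 0 P with hp | hp
    · exact ⟨-|z a|, by simp, by rw [abs_of_nonneg hp]; ring⟩
    · exact ⟨|z a|, by simp, by rw [abs_of_nonpos hp]; ring⟩
  choose r hr1 hr2 hr3 using fun j => exists_row_of_sign hde t (w := c j)
  have hes : ∀ e, elemSymm (univ.erase a) e (update z a t) = elemSymm (univ.erase a) e z :=
    fun e => elemSymm_congr _ fun b hb => update_of_ne (ne_of_mem_erase hb) _ _
  have hE : starEnergy d μ a (update z a t) r = -(|z a| * |P|) +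
      elemSymm (univ.erase a) (d + 1) z + ∑ j, -(|z a| * ∏ l, |c j l|) +
      μ * (∑ b, z b ^ (d + 1) + ∑ j, ∑ l, c j l ^ (d + 1)) := by
    rw [starEnergy, elemSymm_update, update_self, htP, mul_sum, sum_update_pow,
      ← add_sum_erase univ (fun b => z b ^ (d + 1)) (mem_univ a), ← hde.pow_abs t, ht, hde.pow_abs]
    simp only [hr2, hr3, ht]
  have hvP : -(|z a| * |P|) ≤ v * P := by
    have := neg_abs_le (v * P)
    rw [abs_mul] at this
    nlinarith [abs_nonneg P]
  have hqc : ∀ j ∈ univ, -(|z a| * ∏ l, |c j l|) ≤ q j * ∏ l, c j l := fun j _ => by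
    have h1 := neg_abs_le (q j * ∏ l, c j l)
    rw [abs_mul, Finset.abs_prod] at h1
    have h2 : 0 ≤ ∏ l, |c j l| := prod_nonneg fun l _ => abs_nonneg _
    nlinarith [hq j]
  have hsum := sum_le_sum hqc
  have hnn := h (update z a t) r
  refine ⟨by linarith, fun hW0 hz => ?_⟩
  -- The star energy lies between 0 and W, so W = 0 makes every termwise estimate an equality.
  have hE0 : starEnergy d μ a (update z a t) r = 0 := by linarith
  have hza : 0 < |z a| := abs_pos.2 hz
  have hta : update z a t a ≠ 0 := by
    rw [update_self, ← abs_pos, ht]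
    exact hza
  have hμ := pos_of_starEnergy_nonneg hde hn h
  refine ⟨?_, fun j => ?_, fun hJ => ⟨fun j l => ?_, fun b hb => ?_⟩⟩
  · have hP0 : P ≠ 0 := by
      rw [hP, ← hes]
      exact elemSymm_erase_ne_zero h hE0 hd hde hn hta
    have heq : v * P = -(|z a| * |P|) := by linarith
    have := congrArg abs heq
    rw [abs_neg, abs_mul, abs_mul, abs_abs, abs_abs] at this
    exact mul_right_cancel₀ (abs_pos.2 hP0).ne' this
  · have heq : q j * ∏ l, c j l = -(|z a| * ∏ l, |c j l|) :=
      ((sum_eq_sum_iff_of_le hqc).1 (by linarith) j (mem_univ j)).symm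
    have hrow := row_prod_neg hd hde hμ hta (row_minimal h hE0 j)
    rw [update_self, hr3, ht] at hrow
    have h2 : ∏ l, |c j l| ≠ 0 := fun h' => by simp [h'] at hrow
    have := congrArg abs heq
    rw [abs_neg, abs_mul, abs_mul, abs_abs, Finset.abs_prod, Finset.abs_prod] at this
    simp only [abs_abs] at this
    exact mul_right_cancel₀ h2 this
  · have hμ' := one_lt_mul_of_starEnergy_nonneg hd hde hn h
    have := row_abs_lt hd hde hμ' hta (row_minimal h hE0 j) l
    rwa [update_self, ht, hr1] at this
  · have := abs_ne_center h hE0 hd hde hn hta hb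
    rwa [update_self, ht, update_of_ne hb] at this

end StarEnergy

/-! ### Rooting hypertrees at an arbitrary vertex -/

section Rooting

variable {α : Type*}

/-- A rooting of a hypergraph at the vertex `p`: the choice of a parent in every edge such that
every vertex other than `p` is a child in exactly one edge, and `p` is a child in none. -/
structure IsRooting (G : Hypergraph α) (p : α) (par : Set α → α) : Prop where
  par_mem : ∀ e ∈ E(G), par e ∈ e
  disjoint : ∀ e ∈ E(G), ∀ f ∈ E(G), ∀ v, v ∈ e \ {par e} → v ∈ f \ {par f} → e = f
  child_iff : ∀ v, (∃ e ∈ E(G), v ∈ e \ {par e}) ↔ v ∈ V(G) ∧ v ≠ p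

/-- A path from `u` to `w` with distinct vertices and distinct edges, all of them in `S`. -/
def HasPath (S : Set (Set α)) (u w : α) : Prop :=
  ∃ (l : ℕ) (v : ℕ → α) (e : ℕ → Set α), v 0 = u ∧ v l = w ∧ Set.InjOn v (Set.Iic l) ∧
    Set.InjOn e (Set.Iio l) ∧ ∀ i < l, e i ∈ S ∧ v i ∈ e i ∧ v (i + 1) ∈ e i

lemma HasPath.refl (S : Set (Set α)) (u : α) : HasPath S u u :=
  ⟨0, fun _ => u, fun _ => ∅, rfl, rfl, fun i hi j hj _ => by simp_all, fun i hi => by simp at hi,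
    fun i hi => by simp at hi⟩

lemma HasPath.mono {S S' : Set (Set α)} (h : S ⊆ S') {u w : α} : HasPath S u w → HasPath S' u w :=
  fun ⟨l, v, e, h0, hl, hv, he, hi⟩ => ⟨l, v, e, h0, hl, hv, he, fun i hil =>
    ⟨h (hi i hil).1, (hi i hil).2⟩⟩

lemma HasPath.symm {S : Set (Set α)} {u w : α} : HasPath S u w → HasPath S w u := by
  rintro ⟨l, v, e, h0, hl, hv, he, hi⟩
  refine ⟨l, fun i => v (l - i), fun i => e (l - 1 - i), by simpa using hl, by simpa using h0,
    fun i hil j hjl hij => ?_, fun i hil j hjl hij => ?_, fun i hil => ?_⟩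
  · simp only [Set.mem_Iic] at hil hjl
    have := hv (by simp) (by simp) hij
    omega
  · simp only [Set.mem_Iio] at hil hjl
    have := he (by simp; omega) (by simp; omega) hij
    omega
  · obtain ⟨h1, h2, h3⟩ := hi (l - 1 - i) (by omega)
    refine ⟨h1, ?_, ?_⟩
    · have : l - 1 - i + 1 = l - i := by omega
      rwa [this] at h3
    · have : l - 1 - i = l - (i + 1) := by omega
      rw [this] at h2
      simpa [this] using h2

/-- The edge f is put in front. The vertex w is new because it lies in no edge of S; `hwu` is needed
for a path of length zero. -/
lemma HasPath.cons {S : Set (Set α)} {u w q : α} {f : Set α} (h : HasPath S q u) (hf : f ∉ S)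
    (hwf : w ∈ f) (hqf : q ∈ f) (hw : w ∉ ⋃₀ S) (hwu : w ≠ u) : HasPath (insert f S) w u := by
  obtain ⟨l, v, e, h0, hl, hv, he, hi⟩ := h
  have hwv : ∀ i ≤ l, v i ≠ w := by
    rintro i hil rfl
    rcases hil.lt_or_eq with h | rfl
    · exact hw ⟨e i, (hi i h).1, (hi i h).2.1⟩
    · exact hwu hl
  have hfe : ∀ i < l, e i ≠ f := by
    rintro i hil rfl
    exact hf (hi i hil).1
  refine ⟨l + 1, fun i => Nat.casesOn i w v, fun i => Nat.casesOn i f e, rfl, hl, ?_, ?_, ?_⟩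
  · rintro (_ | i) hil (_ | j) hjl hij
    · rfl
    · exact absurd hij.symm (hwv j (by simpa using hjl))
    · exact absurd hij (hwv i (by simpa using hil))
    · simp only [Set.mem_Iic, add_le_add_iff_right] at hil hjl
      rw [hv hil hjl hij]
  · rintro (_ | i) hil (_ | j) hjl hij
    · rfl
    · exact absurd hij.symm (hfe j (by simpa using hjl))
    · exact absurd hij (hfe i (by simpa using hil))
    · simp only [Set.mem_Iio, add_lt_add_iff_right] at hil hjl
      rw [he hil hjl hij]
  · rintro (_ | i) hil
    · exact ⟨Set.mem_insert _ _, hwf, by simpa [h0] using hqf⟩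
    · have := hi i (by omega)
      exact ⟨Set.mem_insert_of_mem _ this.1, this.2⟩

/-- If the ends were different, f would close the path to a cycle. -/
lemma IsAcyclic.eq_of_hasPath {G : Hypergraph α} (hG : G.IsAcyclic) {S : Set (Set α)}
    (hS : S ⊆ E(G)) {u w : α} (h : HasPath S u w) {f : Set α} (hf : f ∈ E(G)) (hfS : f ∉ S)
    (hu : u ∈ f) (hw : w ∈ f) : u = w := by
  obtain ⟨l, v, e, h0, hl, hv, he, hi⟩ := h
  rcases l with _ | l
  · rw [← h0, ← hl]
  have hfe : ∀ i < l + 1, e i ≠ f := by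
    rintro i hil rfl
    exact hfS (hi i hil).1
  refine absurd ⟨l, fun i => v i, fun i => if (i : ℕ) = l + 1 then f else e i, ?_, ?_, ?_⟩ hG
  · intro i j hij
    exact Fin.ext (hv (by simp; omega) (by simp; omega) hij)
  · intro i j hij
    have hi' := i.2
    have hj' := j.2
    simp only at hij
    split_ifs at hij with h1 h2 h2
    · exact Fin.ext (h1.trans h2.symm)
    · exact absurd hij.symm (hfe j (by omega))
    · exact absurd hij (hfe i (by omega))
    · exact Fin.ext (he (by simp; omega) (by simp; omega) hij)
  · intro i
    have hi' := i.2
    simp only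
    split_ifs with h1
    · have : i = Fin.last (l + 1) := Fin.ext h1
      subst this
      refine ⟨hf, by simpa [hl] using hw, ?_⟩
      rw [Fin.last_add_one]
      simpa [h0] using hu
    · obtain ⟨h2, h3, h4⟩ := hi i (by omega)
      refine ⟨hS h2, h3, ?_⟩
      rwa [Fin.val_add_one_of_lt (by rw [Fin.lt_def]; simp; omega)]

lemma mem_of_reflTransGen_adj {G : Hypergraph α} {U : Set α}
    (hU : ∀ e ∈ E(G), ∀ v ∈ e, v ∈ U → e ⊆ U) {p v : α} (hp : p ∈ U)
    (h : Relation.ReflTransGen G.Adj p v) : v ∈ U := by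
  induction h with
  | refl => exact hp
  | tail _ h ih =>
    obtain ⟨e, he, h1, h2⟩ := h
    exact hU e he _ h1 ih h2

/-- The rooted part grows from p by one edge at a time. An added edge meets the covered vertices in
a single vertex, which becomes its parent: with two such vertices, the path between them inside S
and the new edge would form a cycle. The paths are part of the induction for this reason only. -/
lemma IsHypertree.exists_partial_rooting {k : ℕ} (hk : k ≠ 0) {G : Hypergraph α}
    (hG : G.IsHypertree k) {p : α} (hp : p ∈ V(G)) (N : ℕ) (hN : N ≤ E(G).ncard) :
    ∃ (S : Set (Set α)) (par : Set α → α), S ⊆ E(G) ∧ S.ncard = N ∧ (∀ e ∈ S, par e ∈ e) ∧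
      (∀ e ∈ S, ∀ f ∈ S, ∀ v, v ∈ e \ {par e} → v ∈ f \ {par f} → e = f) ∧
      (∀ v, (∃ e ∈ S, v ∈ e \ {par e}) ↔ v ∈ ⋃₀ S ∧ v ≠ p) ∧
      ∀ u ∈ insert p (⋃₀ S), ∀ w ∈ insert p (⋃₀ S), HasPath S u w := by
  classical
  have hfin : E(G).Finite := hG.finite.finite_subsets.subset edgeSet_subset_powerset_vertexSet
  induction N with
  | zero =>
    refine ⟨∅, fun _ => p, by simp, by simp, by simp, by simp, by simp, ?_⟩
    simp only [Set.sUnion_empty, insert_empty_eq, Set.mem_singleton_iff]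
    rintro u rfl w rfl
    exact HasPath.refl _ _
  | succ N ih =>
    obtain ⟨S, par, hS, hSN, hpar, hdisj, hchild, hpath⟩ := ih (by omega)
    obtain ⟨f, hf, hfS, q, hqf, hq⟩ :
        ∃ f ∈ E(G), f ∉ S ∧ ∃ q ∈ f, q ∈ insert p (⋃₀ S) := by
      -- Otherwise the covered vertices are closed under adjacency, so by connectedness they are all
      -- the vertices, although an edge remains.
      by_contra! hcon
      have hclosed : ∀ e ∈ E(G), ∀ v ∈ e, v ∈ insert p (⋃₀ S) → e ⊆ insert p (⋃₀ S) := by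
        intro e he v hve hv
        by_cases heS : e ∈ S
        · exact fun w hw => Set.mem_insert_of_mem _ ⟨e, heS, hw⟩
        · exact absurd hv (hcon e he heS v hve)
      obtain ⟨e, he, heS⟩ : ∃ e ∈ E(G), e ∉ S := by
        by_contra! h
        have : S = E(G) := hS.antisymm h
        rw [← this] at hN
        omega
      obtain ⟨v, hv⟩ := Set.nonempty_of_ncard_ne_zero (s := e)
        (by rw [(hG.uniform e he).2]; exact hk)
      exact hcon e he heS v hv (mem_of_reflTransGen_adj hclosed (Set.mem_insert _ _)
        (hG.connected.2 p hp v (he.subset_vertexSet hv)))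
    have hnew : ∀ w ∈ f, w ≠ q → w ∉ insert p (⋃₀ S) := fun w hw hwq hwU =>
      hwq (hG.acyclic.eq_of_hasPath hS (hpath w hwU q hq) hf hfS hw hqf)
    set par' := Function.update par f q with hpar'
    have hparf : par' f = q := Function.update_self _ _ _
    have hpare : ∀ e ∈ S, par' e = par e := fun e he =>
      Function.update_of_ne (fun h : e = f => hfS (h ▸ he)) _ _
    refine ⟨insert f S, par', Set.insert_subset hf hS, ?_, ?_, ?_, ?_, ?_⟩
    · rw [Set.ncard_insert_of_notMem hfS (hfin.subset hS), hSN]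
    · rintro e (rfl | he)
      · rwa [hparf]
      · rw [hpare e he]
        exact hpar e he
    · rintro e (rfl | he) g (rfl | hg) v hve hvg
      · rfl
      · rw [hparf] at hve
        exact absurd (Set.mem_insert_of_mem _ (Set.mem_sUnion_of_mem hvg.1 hg)) (hnew v hve.1 hve.2)
      · rw [hparf] at hvg
        exact absurd (Set.mem_insert_of_mem _ (Set.mem_sUnion_of_mem hve.1 he)) (hnew v hvg.1 hvg.2)
      · rw [hpare e he] at hve
        rw [hpare g hg] at hvg
        exact hdisj e he g hg v hve hvg
    · intro v
      constructor
      · rintro ⟨e, rfl | he, hv⟩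
        · rw [hparf] at hv
          refine ⟨⟨e, Set.mem_insert _ _, hv.1⟩, ?_⟩
          rintro rfl
          exact hnew v hv.1 hv.2 (Set.mem_insert _ _)
        · rw [hpare e he] at hv
          exact ⟨⟨e, Set.mem_insert_of_mem _ he, hv.1⟩, ((hchild v).1 ⟨e, he, hv⟩).2⟩
      · rintro ⟨hv, hvp⟩
        by_cases hvS : v ∈ ⋃₀ S
        · obtain ⟨e, he, hv⟩ := (hchild v).2 ⟨hvS, hvp⟩
          exact ⟨e, Set.mem_insert_of_mem _ he, by rwa [hpare e he]⟩
        · obtain ⟨e, rfl | he, hv⟩ := hv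
          · refine ⟨e, Set.mem_insert _ _, hv, ?_⟩
            rw [hparf]
            rintro rfl
            rcases hq with h | h
            · exact hvp h
            · exact hvS h
          · exact absurd (Set.mem_sUnion_of_mem hv he) hvS
    · have hcase : ∀ w ∈ insert p (⋃₀ insert f S),
          w ∈ insert p (⋃₀ S) ∨ w ∈ f ∧ w ∉ insert p (⋃₀ S) := by
        rintro w hw
        by_cases h : w ∈ insert p (⋃₀ S)
        · exact Or.inl h
        · refine Or.inr ⟨?_, h⟩
          rcases hw with rfl | ⟨e, rfl | he, hw⟩
          · exact absurd (Set.mem_insert _ _) h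
          · exact hw
          · exact absurd (Set.mem_insert_of_mem _ (Set.mem_sUnion_of_mem hw he)) h
      have hon : ∀ u ∈ insert p (⋃₀ S), ∀ w ∈ f, w ∉ insert p (⋃₀ S) →
          HasPath (insert f S) w u := fun u hu w hw hwU =>
        (hpath q hq u hu).cons hfS hw hqf (fun h => hwU (Set.mem_insert_of_mem _ h))
          (fun h => hwU (h ▸ hu))
      intro u hu w hw
      rcases hcase u hu with hu | ⟨huf, hu⟩ <;> rcases hcase w hw with hw | ⟨hwf, hw⟩
      · exact (hpath u hu w hw).mono (Set.subset_insert _ _)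
      · exact (hon u hu w hwf hw).symm
      · exact hon w hw u huf hu
      · by_cases huw : u = w
        · rw [huw]
          exact HasPath.refl _ _
        · exact (HasPath.refl S w).cons hfS huf hwf
            (fun h => hu (Set.mem_insert_of_mem _ h)) huw

lemma IsHypertree.exists_isRooting {k : ℕ} (hk : k ≠ 0) {G : Hypergraph α}
    (hG : G.IsHypertree k) {p : α} (hp : p ∈ V(G)) : ∃ par, G.IsRooting p par := by
  have hfin : E(G).Finite := hG.finite.finite_subsets.subset edgeSet_subset_powerset_vertexSet
  obtain ⟨S, par, hS, hSN, hpar, hdisj, hchild, -⟩ := hG.exists_partial_rooting hk hp _ le_rfl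
  obtain rfl : S = E(G) := Set.eq_of_subset_of_ncard_le hS hSN.ge hfin
  refine ⟨par, hpar, hdisj, fun v => (hchild v).trans (and_congr_left fun hv => ?_)⟩
  refine ⟨fun h => sUnion_edgeSet_subset_vertexSet h, fun h => ?_⟩
  have : v ∈ insert p (⋃₀ E(G)) := mem_of_reflTransGen_adj
    (fun e he _ _ _ w hw => Set.mem_insert_of_mem _ (Set.mem_sUnion_of_mem hw he))
    (Set.mem_insert _ _)
    (hG.connected.2 p hp v h)
  exact this.resolve_left hv

end Rooting

/-! ### Invariance under isomorphism -/

section Isomorphism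

variable {α β γ : Type*}

lemma Isomorphic.refl (G : Hypergraph α) : G.Isomorphic G :=
  ⟨Equiv.refl _, fun e => by rw [Equiv.coe_refl, Set.image_id]⟩

lemma Isomorphic.symm {G : Hypergraph α} {H : Hypergraph β} (h : G.Isomorphic H) :
    H.Isomorphic G := by
  obtain ⟨φ, hφ⟩ := h
  refine ⟨φ.symm, fun e => ?_⟩
  rw [hφ, φ.image_symm_image]

lemma Isomorphic.trans {G : Hypergraph α} {H : Hypergraph β} {K : Hypergraph γ}
    (h : G.Isomorphic H) (h' : H.Isomorphic K) : G.Isomorphic K := by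
  obtain ⟨φ, hφ⟩ := h
  obtain ⟨ψ, hψ⟩ := h'
  refine ⟨φ.trans ψ, fun e => ?_⟩
  rw [hφ, hψ, ← Set.image_comp ψ φ]
  rfl

lemma isomorphic_image (G : Hypergraph α) {f : α → β} (hf : f.Injective) :
    G.Isomorphic (G.image f) := by
  let φ : V(G) ≃ V(G.image f) := Equiv.Set.image f V(G) hf
  refine ⟨φ, fun e => ?_⟩
  have : Subtype.val '' (φ '' e) = f '' (Subtype.val '' e) := by
    rw [← Set.image_comp, ← Set.image_comp]
    rfl
  rw [this]
  exact (hf.image_injective.mem_set_image).symm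

lemma Isomorphic.image_edgeSet {G : Hypergraph α} {H : Hypergraph β} {φ : V(G) ≃ V(H)}
    (hφ : ∀ e : Set V(G), (Subtype.val '' e ∈ E(G) ↔ Subtype.val '' (φ '' e) ∈ E(H))) :
    {e : Set V(H) | Subtype.val '' e ∈ E(H)} =
      Set.image φ '' {e : Set V(G) | Subtype.val '' e ∈ E(G)} := by
  ext e
  constructor
  · intro he
    refine ⟨φ.symm '' e, ?_, φ.image_symm_image e⟩
    rw [Set.mem_ofPred_eq, hφ, φ.image_symm_image]
    exact he
  · rintro ⟨e, he, rfl⟩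
    exact (hφ e).1 he

lemma ncard_edgeSet (G : Hypergraph α) :
    {e : Set V(G) | Subtype.val '' e ∈ E(G)}.ncard = E(G).ncard := by
  rw [← Set.ncard_image_of_injective _ Subtype.val_injective.image_injective]
  congr 1
  ext e
  constructor
  · rintro ⟨e, he, rfl⟩
    exact he
  · intro he
    have : Subtype.val '' (Subtype.val ⁻¹' e : Set V(G)) = e := by
      rw [Subtype.image_preimage_coe, Set.inter_eq_right]
      exact he.subset_vertexSet
    exact ⟨Subtype.val ⁻¹' e, by rwa [Set.mem_ofPred_eq, this], this⟩

lemma Isomorphic.ncard_edgeSet_eq {G : Hypergraph α} {H : Hypergraph β} (h : G.Isomorphic H) :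
    E(G).ncard = E(H).ncard := by
  obtain ⟨φ, hφ⟩ := h
  rw [← ncard_edgeSet G, ← ncard_edgeSet H, image_edgeSet hφ,
    Set.ncard_image_of_injective _ φ.injective.image_injective]

lemma Isomorphic.isUniform {k : ℕ} {G : Hypergraph α} {H : Hypergraph β} (h : G.Isomorphic H)
    (hG : G.IsUniform k) : H.IsUniform k := by
  obtain ⟨φ, hφ⟩ := h
  intro e he
  have he' : Subtype.val '' (Subtype.val ⁻¹' e : Set V(H)) = e := by
    rw [Subtype.image_preimage_coe, Set.inter_eq_right]
    exact he.subset_vertexSet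
  have h1 : (Subtype.val ⁻¹' e : Set V(H)) ∈ {e : Set V(H) | Subtype.val '' e ∈ E(H)} := by
    rwa [Set.mem_ofPred_eq, he']
  rw [image_edgeSet hφ] at h1
  obtain ⟨f, hf, hfe⟩ := h1
  have h2 := hG _ hf
  rw [Set.ncard_image_of_injective _ Subtype.val_injective,
    Set.finite_image_iff Subtype.val_injective.injOn] at h2
  rw [← he', ← hfe, Set.ncard_image_of_injective _ Subtype.val_injective,
    Set.ncard_image_of_injective _ φ.injective]
  exact ⟨(h2.1.image _).image _, h2.2⟩

open Finset in
lemma edgeForm_image {I I' : Type*} [DecidableEq I'] (E : Finset (Finset I)) {f : I → I'}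
    (hf : f.Injective) (x : I' → ℝ) :
    edgeForm (E.image (Finset.image f)) x = edgeForm E (x ∘ f) := by
  rw [edgeForm, edgeForm, sum_image (image_injective hf).injOn]
  exact sum_congr rfl fun e _ => prod_image hf.injOn

open Classical in
lemma Isomorphic.edgeFinsets_eq {G : Hypergraph α} {H : Hypergraph β} [Fintype V(G)]
    [Fintype V(H)] {φ : V(G) ≃ V(H)}
    (hφ : ∀ e : Set V(G), (Subtype.val '' e ∈ E(G) ↔ Subtype.val '' (φ '' e) ∈ E(H))) :
    H.edgeFinsets = G.edgeFinsets.image (Finset.image φ) := by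
  ext e
  simp only [Finset.mem_image, mem_edgeFinsets]
  constructor
  · intro he
    refine ⟨e.image φ.symm, ?_, by simp [Finset.image_image]⟩
    rw [hφ, Finset.coe_image, φ.image_symm_image]
    exact he
  · rintro ⟨e, he, rfl⟩
    rw [Finset.coe_image]
    exact (hφ _).1 he

lemma Isomorphic.isLeastQuotient {k : ℕ} {G : Hypergraph α} {H : Hypergraph β} [Fintype V(G)]
    [Fintype V(H)] (h : G.Isomorphic H) {ν : ℝ}
    (hG : IsLeastQuotient k (edgeForm G.edgeFinsets) ν) :
    IsLeastQuotient k (edgeForm H.edgeFinsets) ν := by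
  classical
  obtain ⟨φ, hφ⟩ := h
  have hform : ∀ x, edgeForm H.edgeFinsets x = edgeForm G.edgeFinsets (x ∘ φ) := fun x => by
    rw [edgeFinsets_eq hφ, ← edgeForm_image _ φ.injective]
  have hsum : ∀ x : V(H) → ℝ, ∑ v, x v ^ k = ∑ v, (x ∘ φ) v ^ k := fun x =>
    (φ.sum_comp fun v => x v ^ k).symm
  refine ⟨fun x => ?_, ?_⟩
  · rw [hform, hsum]
    exact hG.1 _
  · obtain ⟨x, hx0, hx⟩ := hG.2
    have hxφ : (x ∘ φ.symm) ∘ φ = x := by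
      ext v
      simp
    refine ⟨x ∘ φ.symm, fun h => hx0 ?_, ?_⟩
    · rw [← hxφ, h]
      rfl
    · rw [hform, hsum, hxφ, hx]

lemma Isomorphic.nonempty {G : Hypergraph α} {H : Hypergraph β} (h : G.Isomorphic H)
    (hG : V(G).Nonempty) : V(H).Nonempty := by
  obtain ⟨φ, -⟩ := h
  obtain ⟨v, hv⟩ := hG
  exact ⟨_, (φ ⟨v, hv⟩).2⟩

end Isomorphism

/-! ### Explicit models of a complete hypergraph with a rooted family of edges -/

section Model

open Finset

variable {n m k : ℕ}

/-- The complete uniform hypergraph on the vertices `inl b`, `b ≠ a`, and `c₀`, together with `m`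
further edges, the `j`-th of which consists of the parent `q j` and of the `k - 1` children
`inr (j, l)`. -/
def rootedModel (a : Fin n) (c₀ : Fin n ⊕ Fin m × Fin (k - 1))
    (q : Fin m → Fin n ⊕ Fin m × Fin (k - 1)) : Hypergraph (Fin n ⊕ Fin m × Fin (k - 1)) where
  vertexSet := Set.univ
  edgeSet := Set.image (Function.update Sum.inl a c₀) '' {s | s.ncard = k} ∪
    Set.range fun j => insert (q j) (Set.range fun l => Sum.inr (j, l))
  subset_vertexSet_of_mem_edgeSet' := fun _ _ => Set.subset_univ _

/-- The edges of `rootedModel a c₀ q` are listed without repetition. -/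
structure IsProperModel (a : Fin n) (c₀ : Fin n ⊕ Fin m × Fin (k - 1))
    (q : Fin m → Fin n ⊕ Fin m × Fin (k - 1)) : Prop where
  injective_base : Function.Injective (Function.update Sum.inl a c₀)
  parent_ne : ∀ j l, q j ≠ Sum.inr (j, l)
  injective_edge : Function.Injective fun j =>
    (insert (q j) (Set.range fun l => Sum.inr (j, l)) : Set (Fin n ⊕ Fin m × Fin (k - 1)))
  base_ne_edge : ∀ (s : Set (Fin n)) (j : Fin m), s.ncard = k →
    Function.update Sum.inl a c₀ '' s ≠ insert (q j) (Set.range fun l => Sum.inr (j, l))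

/-- The edges of `rootedModel a c₀ q` as finite sets. -/
def rootedModelFinsets (a : Fin n) (c₀ : Fin n ⊕ Fin m × Fin (k - 1))
    (q : Fin m → Fin n ⊕ Fin m × Fin (k - 1)) : Finset (Finset (Fin n ⊕ Fin m × Fin (k - 1))) :=
  (powersetCard k univ).image (Finset.image (Function.update Sum.inl a c₀)) ∪
    univ.image fun j => insert (q j) (univ.image fun l => Sum.inr (j, l))

lemma mem_rootedModelFinsets (a : Fin n) (c₀ : Fin n ⊕ Fin m × Fin (k - 1))
    (q : Fin m → Fin n ⊕ Fin m × Fin (k - 1)) (e : Finset (Fin n ⊕ Fin m × Fin (k - 1))) :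
    e ∈ rootedModelFinsets a c₀ q ↔ (e : Set _) ∈ E(rootedModel a c₀ q) := by
  simp only [rootedModelFinsets, mem_union, mem_image, mem_powersetCard_univ, mem_univ, true_and,
    rootedModel, Set.mem_union, Set.mem_image, Set.mem_range, Set.mem_ofPred_eq]
  refine or_congr ⟨?_, ?_⟩ (exists_congr fun j => ?_)
  · rintro ⟨s, hs, rfl⟩
    exact ⟨s, by rw [Set.ncard_coe_finset, hs], by rw [coe_image]⟩
  · rintro ⟨s, hs, hse⟩
    refine ⟨s.toFinite.toFinset, by rw [← Set.ncard_eq_toFinset_card, hs], ?_⟩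
    apply Finset.coe_injective
    rw [coe_image, Set.Finite.coe_toFinset, hse]
  · rw [← Finset.coe_inj]
    simp

/-- Properness excludes repetitions among and inside the listed edges. The label `inl a` is reserved
for the root, so the slot a of the complete hypergraph is filled with the value at `c₀`. -/
lemma edgeForm_rootedModelFinsets {a : Fin n} {c₀ : Fin n ⊕ Fin m × Fin (k - 1)}
    {q : Fin m → Fin n ⊕ Fin m × Fin (k - 1)} (h : IsProperModel a c₀ q)
    (y : Fin n ⊕ Fin m × Fin (k - 1) → ℝ) :
    edgeForm (rootedModelFinsets a c₀ q) y =
      elemSymm univ k (Function.update (fun b => y (Sum.inl b)) a (y c₀)) +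
        ∑ j, y (q j) * ∏ l, y (Sum.inr (j, l)) := by
  have hinj : Function.Injective fun j : Fin m =>
      insert (q j) (univ.image fun l : Fin (k - 1) => (Sum.inr (j, l) : Fin n ⊕ _)) := by
    intro i j hij
    refine h.injective_edge ?_
    simpa using congrArg (fun s : Finset _ => (s : Set (Fin n ⊕ Fin m × Fin (k - 1)))) hij
  rw [edgeForm, rootedModelFinsets, sum_union, sum_image (image_injective h.injective_base).injOn,
    sum_image hinj.injOn]
  · congr 1
    · refine sum_congr rfl fun s _ => ?_
      rw [prod_image h.injective_base.injOn]
      refine prod_congr rfl fun b _ => ?_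
      by_cases hb : b = a
      · subst hb
        simp
      · rw [Function.update_of_ne hb, Function.update_of_ne hb]
    · refine sum_congr rfl fun j _ => ?_
      rw [prod_insert, prod_image]
      · intro l _ l' _ hll
        simpa using hll
      · simp only [mem_image, mem_univ, true_and, not_exists]
        exact fun l hl => h.parent_ne j l hl.symm
  · rw [disjoint_left]
    intro e he he'
    obtain ⟨s, hs, rfl⟩ := mem_image.1 he
    obtain ⟨j, -, hj⟩ := mem_image.1 he'
    refine h.base_ne_edge s j (by rw [Set.ncard_coe_finset, (mem_powersetCard.1 hs).2]) ?_
    simpa using (congrArg (fun s : Finset _ => (s : Set (Fin n ⊕ Fin m × Fin (k - 1)))) hj).symm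

lemma edgeForm_image_rootedModel {γ : Type*} {a : Fin n} {c₀ : Fin n ⊕ Fin m × Fin (k - 1)}
    {q : Fin m → Fin n ⊕ Fin m × Fin (k - 1)} (h : IsProperModel a c₀ q)
    {ρ : Fin n ⊕ Fin m × Fin (k - 1) → γ} (hρ : ρ.Injective)
    [Fintype V((rootedModel a c₀ q).image ρ)] (x : V((rootedModel a c₀ q).image ρ) → ℝ)
    {y : Fin n ⊕ Fin m × Fin (k - 1) → ℝ} (hy : ∀ i, y i = x ⟨ρ i, i, trivial, rfl⟩) :
    edgeForm ((rootedModel a c₀ q).image ρ).edgeFinsets x =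
      elemSymm univ k (Function.update (fun b => y (Sum.inl b)) a (y c₀)) +
        ∑ j, y (q j) * ∏ l, y (Sum.inr (j, l)) := by
  classical
  set ρ' : Fin n ⊕ Fin m × Fin (k - 1) → V((rootedModel a c₀ q).image ρ) :=
    fun i => ⟨ρ i, i, trivial, rfl⟩ with hρ'
  have hinj : ρ'.Injective := fun i j hij => hρ (congrArg Subtype.val hij)
  have hval : ∀ e : Set (Fin n ⊕ Fin m × Fin (k - 1)), Subtype.val '' (ρ' '' e) = ρ '' e :=
    fun e => by rw [Set.image_image]
  have hE : ((rootedModel a c₀ q).image ρ).edgeFinsets =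
      (rootedModelFinsets a c₀ q).image (Finset.image ρ') := by
    ext e
    rw [mem_edgeFinsets, mem_image]
    constructor
    · rintro ⟨f, hf, hfe⟩
      refine ⟨f.toFinite.toFinset, ?_, ?_⟩
      · rwa [mem_rootedModelFinsets, Set.Finite.coe_toFinset]
      · apply Finset.coe_injective
        apply Subtype.val_injective.image_injective
        rw [coe_image, Set.Finite.coe_toFinset, hval, hfe]
    · rintro ⟨f, hf, rfl⟩
      rw [coe_image, hval]
      exact ⟨f, (mem_rootedModelFinsets _ _ _ _).1 hf, rfl⟩
  have hxy : x ∘ ρ' = y := funext fun i => (hy i).symm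
  rw [hE, edgeForm_image _ hinj, hxy, edgeForm_rootedModelFinsets h]

lemma sum_pow_image_rootedModel {γ : Type*} {a : Fin n} {c₀ : Fin n ⊕ Fin m × Fin (k - 1)}
    {q : Fin m → Fin n ⊕ Fin m × Fin (k - 1)}
    {ρ : Fin n ⊕ Fin m × Fin (k - 1) → γ} (hρ : ρ.Injective)
    [Fintype V((rootedModel a c₀ q).image ρ)] (x : V((rootedModel a c₀ q).image ρ) → ℝ)
    {y : Fin n ⊕ Fin m × Fin (k - 1) → ℝ} (hy : ∀ i, y i = x ⟨ρ i, i, trivial, rfl⟩) (t : ℕ) :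
    ∑ v, x v ^ t = ∑ b, y (Sum.inl b) ^ t + ∑ j, ∑ l, y (Sum.inr (j, l)) ^ t := by
  have hbij : Function.Bijective (fun i => ⟨ρ i, i, trivial, rfl⟩ :
      Fin n ⊕ Fin m × Fin (k - 1) → V((rootedModel a c₀ q).image ρ)) := by
    refine ⟨fun i j hij => hρ (congrArg Subtype.val hij), ?_⟩
    rintro ⟨_, i, -, rfl⟩
    exact ⟨i, rfl⟩
  rw [← hbij.sum_comp fun v => x v ^ t, Fintype.sum_sum_type, Fintype.sum_prod_type]
  simp only [hy]

/-- A hypergraph whose edges are those of a complete uniform hypergraph and those of a rooted family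
is the image of a rooted model. -/
lemma exists_eq_image_rootedModel {γ J : Type*} (H : Hypergraph γ) (hJ : Nat.card J = m) [Finite J]
    {κ : Fin n → γ} (hκ : κ.Injective) {ed : J → Set γ} (hed : ed.Injective)
    (hE : E(H) = Set.image κ '' {s | s.ncard = k} ∪ Set.range ed)
    (hdis : ∀ (s : Set (Fin n)) j, s.ncard = k → κ '' s ≠ ed j)
    (hcard : ∀ j, (ed j).Finite ∧ (ed j).ncard = k) {p : γ} (hp : p ∈ V(H))
    (hκV : ∀ b, κ b ∈ V(H)) {a : Fin n} (ha : ∀ b, b ≠ a → κ b ≠ p) {par : J → γ}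
    (hpar : ∀ j, par j ∈ ed j)
    (hdisj : ∀ i j v, v ∈ ed i \ {par i} → v ∈ ed j \ {par j} → i = j)
    (hchild : ∀ v, (∃ j, v ∈ ed j \ {par j}) ↔ v ∈ V(H) ∧ v ≠ p ∧ ∀ b, b ≠ a → v ≠ κ b) :
    ∃ (c₀ : Fin n ⊕ Fin m × Fin (k - 1)) (q : Fin m → Fin n ⊕ Fin m × Fin (k - 1))
      (ρ : Fin n ⊕ Fin m × Fin (k - 1) → γ), IsProperModel a c₀ q ∧ ρ.Injective ∧
        ρ (Sum.inl a) = p ∧ H = (rootedModel a c₀ q).image ρ := by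
  classical
  let ε : Fin m ≃ J := (Finite.equivFinOfCardEq hJ).symm
  have hcard' : ∀ j, Nat.card ↥(ed j \ {par j}) = k - 1 := fun j => by
    rw [Nat.card_coe_set_eq, Set.ncard_sdiff_singleton_of_mem (hpar j), (hcard j).2]
  have hfin : ∀ j, Finite ↥(ed j \ {par j}) := fun j => (hcard j).1.sdiff
  let g : ∀ j, Fin (k - 1) ≃ ↥(ed j \ {par j}) := fun j =>
    (Finite.equivFinOfCardEq (hcard' j)).symm
  -- The label `inl a` goes to p instead of `κ a`. The vertex `κ a` is either p or a child, and `c₀`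
  -- will be its label.
  let ρ : Fin n ⊕ Fin m × Fin (k - 1) → γ :=
    Sum.elim (Function.update κ a p) fun t => (g (ε t.1) t.2 : γ)
  have hinl : ∀ b, b ≠ a → ρ (Sum.inl b) = κ b := fun b hb => Function.update_of_ne hb _ _
  have hinla : ρ (Sum.inl a) = p := Function.update_self _ _ _
  have hinr : ∀ j l, ρ (Sum.inr (j, l)) ∈ ed (ε j) \ {par (ε j)} := fun j l => (g (ε j) l).2
  have hinr' : ∀ j l, ρ (Sum.inr (j, l)) ∈ V(H) ∧ ρ (Sum.inr (j, l)) ≠ p ∧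
      ∀ b, b ≠ a → ρ (Sum.inr (j, l)) ≠ κ b := fun j l => (hchild _).1 ⟨_, hinr j l⟩
  have hlr : ∀ b j l, ρ (Sum.inl b) ≠ ρ (Sum.inr (j, l)) := fun b j l h => by
    by_cases hb : b = a
    · subst hb
      exact (hinr' j l).2.1 (h.symm.trans hinla)
    · exact (hinr' j l).2.2 b hb (h.symm.trans (hinl b hb))
  have hρ : ρ.Injective := by
    rintro (b | ⟨j, l⟩) (b' | ⟨j', l'⟩) h
    · by_cases hb : b = a <;> by_cases hb' : b' = a
      · rw [hb, hb']
      · subst hb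
        rw [hinla, hinl b' hb'] at h
        exact absurd h.symm (ha b' hb')
      · subst hb'
        rw [hinla, hinl b hb] at h
        exact absurd h (ha b hb)
      · rw [hinl b hb, hinl b' hb'] at h
        rw [hκ h]
    · exact absurd h (hlr b j' l')
    · exact absurd h.symm (hlr b' j l)
    · have h1 := hinr j l
      rw [h] at h1
      obtain rfl := ε.injective (hdisj _ _ _ h1 (hinr j' l'))
      obtain rfl := (g (ε j)).injective (Subtype.ext h)
      rfl
  have hrange : ∀ v, v ∈ V(H) ↔ ∃ i, ρ i = v := by
    intro v
    constructor
    · intro hv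
      by_cases hvp : v = p
      · exact ⟨Sum.inl a, by rw [hinla, hvp]⟩
      · by_cases hvb : ∃ b, b ≠ a ∧ v = κ b
        · obtain ⟨b, hb, rfl⟩ := hvb
          exact ⟨Sum.inl b, hinl b hb⟩
        · push Not at hvb
          obtain ⟨j, hj⟩ := (hchild v).2 ⟨hv, hvp, hvb⟩
          obtain ⟨j, rfl⟩ := ε.surjective j
          obtain ⟨l, hl⟩ := (g (ε j)).surjective ⟨v, hj⟩
          exact ⟨Sum.inr (j, l), congrArg Subtype.val hl⟩
    · rintro ⟨b | ⟨j, l⟩, rfl⟩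
      · by_cases hb : b = a
        · rwa [hb, hinla]
        · rw [hinl b hb]
          exact hκV b
      · exact (hinr' j l).1
  obtain ⟨c₀, hc₀⟩ := (hrange _).1 (hκV a)
  have hparV : ∀ j, par j ∈ V(H) := fun j =>
    mem_vertexSet_of_mem_edgeSet (by rw [hE]; exact Or.inr ⟨j, rfl⟩) (hpar j)
  choose q hq using fun j => (hrange _).1 (hparV (ε j))
  have hbase : ρ ∘ Function.update Sum.inl a c₀ = κ := by
    funext b
    by_cases hb : b = a
    · subst hb
      simpa using hc₀
    · simp [Function.update_of_ne hb, hinl b hb]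
  have hedge : ∀ j, ρ '' insert (q j) (Set.range fun l => Sum.inr (j, l)) = ed (ε j) := by
    intro j
    rw [Set.image_insert_eq, hq, ← Set.range_comp]
    have : Set.range (ρ ∘ fun l => Sum.inr (j, l)) = ed (ε j) \ {par (ε j)} := by
      ext v
      constructor
      · rintro ⟨l, rfl⟩
        exact hinr j l
      · intro hv
        obtain ⟨l, hl⟩ := (g (ε j)).surjective ⟨v, hv⟩
        exact ⟨l, congrArg Subtype.val hl⟩
    rw [this, Set.insert_sdiff_singleton, Set.insert_eq_of_mem (hpar _)]
  refine ⟨c₀, q, ρ, ⟨?_, ?_, ?_, ?_⟩, hρ, hinla, ?_⟩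
  · refine Function.Injective.of_comp (f := ρ) ?_
    rwa [hbase]
  · intro j l h
    have := (hinr j l).2
    rw [← h, hq] at this
    exact this rfl
  · intro i j hij
    have := congrArg (Set.image ρ) hij
    simp only [hedge] at this
    exact ε.injective (hed this)
  · intro s j hs h
    have := congrArg (Set.image ρ) h
    rw [hedge, ← Set.image_comp, hbase] at this
    exact hdis s _ hs this
  · apply Hypergraph.ext
    · ext v
      simp [hrange, rootedModel]
    · simp only [image_edgeSet, rootedModel, Set.image_union, hE]
      congr 1
      · rw [Set.image_image]
        refine Set.image_congr fun s _ => ?_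
        rw [← Set.image_comp, hbase]
      · rw [← Set.range_comp, ← ε.surjective.range_comp]
        congr 1
        funext j
        exact (hedge j).symm

end Model

/-! ### Attached hypertrees as rooted models -/

section Attach

variable {α ι : Type*} {W : ι → Type*} {a : ι → α} {r : ∀ i, W i}

lemma attachMap_root (i : ι) : attachMap a r i (r i) = Sum.inl (a i) := if_pos rfl

lemma attachMap_of_ne {i : ι} {w : W i} (h : w ≠ r i) : attachMap a r i w = Sum.inr ⟨i, w⟩ :=
  if_neg h

lemma attachMap_injective (i : ι) : (attachMap a r i).Injective := by
  intro w w' h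
  by_cases hw : w = r i <;> by_cases hw' : w' = r i
  · rw [hw, hw']
  · rw [hw, attachMap_root, attachMap_of_ne hw'] at h
    simp at h
  · rw [hw', attachMap_root, attachMap_of_ne hw] at h
    simp at h
  · rw [attachMap_of_ne hw, attachMap_of_ne hw'] at h
    simpa using h

lemma attachMap_eq_inl {i : ι} {w : W i} {b : α} (h : attachMap a r i w = Sum.inl b) :
    w = r i ∧ a i = b := by
  by_cases hw : w = r i
  · rw [hw, attachMap_root] at h
    exact ⟨hw, Sum.inl_injective h⟩
  · rw [attachMap_of_ne hw] at h
    simp at h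

lemma attachMap_eq_attachMap {i j : ι} {w : W i} {w' : W j} (hij : i ≠ j)
    (h : attachMap a r i w = attachMap a r j w') : w = r i ∧ w' = r j := by
  by_cases hw : w = r i
  · refine ⟨hw, ?_⟩
    rw [hw, attachMap_root] at h
    exact (attachMap_eq_inl h.symm).1
  · rw [attachMap_of_ne hw] at h
    by_cases hw' : w' = r j
    · rw [hw', attachMap_root] at h
      simp at h
    · rw [attachMap_of_ne hw'] at h
      simp [hij] at h

/-- The edges of the attached hypergraphs, as edges of the result. -/
noncomputable def attachEdge (a : ι → α) (T : ∀ i, Hypergraph (W i)) (r : ∀ i, W i)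
    (j : Σ i, E(T i)) : Set (α ⊕ (Σ i, W i)) :=
  attachMap a r j.1 '' j.2

variable {T : ∀ i, Hypergraph (W i)}

lemma edgeSet_attach (G : Hypergraph α) :
    E(G.attach a T r) = Set.image Sum.inl '' E(G) ∪ Set.range (attachEdge a T r) := by
  simp only [attach, image_edgeSet]
  congr 1
  ext e
  simp only [Set.mem_iUnion, Set.mem_image, Set.mem_range, attachEdge]
  constructor
  · rintro ⟨i, f, hf, rfl⟩
    exact ⟨⟨i, f, hf⟩, rfl⟩
  · rintro ⟨⟨i, f, hf⟩, rfl⟩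
    exact ⟨i, f, hf, rfl⟩

variable {k : ℕ}

lemma IsUniform.exists_ne {β : Type*} {G : Hypergraph β} (hk : 2 ≤ k) (hG : G.IsUniform k)
    {e : Set β} (he : e ∈ E(G)) (w : β) : ∃ v ∈ e, v ≠ w :=
  Set.exists_ne_of_one_lt_ncard (by rw [(hG e he).2]; omega) w

/-- Distinct attached hypergraphs share at most their roots, and an edge with at least two vertices
has one that is not the root. -/
lemma attachEdge_injective (hk : 2 ≤ k) (hT : ∀ i, (T i).IsUniform k) :
    (attachEdge a T r).Injective := by
  rintro ⟨i, e, he⟩ ⟨j, f, hf⟩ h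
  simp only [attachEdge] at h
  by_cases hij : i = j
  · subst hij
    obtain rfl := (attachMap_injective i).image_injective h
    rfl
  · obtain ⟨v, hv, hvr⟩ := (hT i).exists_ne hk he (r i)
    obtain ⟨w, -, hw⟩ : attachMap a r i v ∈ attachMap a r j '' f := h ▸ Set.mem_image_of_mem _ hv
    exact absurd (attachMap_eq_attachMap hij hw.symm).1 hvr

lemma image_inl_ne_attachEdge (hk : 2 ≤ k) (hT : ∀ i, (T i).IsUniform k) (s : Set α)
    (j : Σ i, E(T i)) : Sum.inl '' s ≠ attachEdge a T r j := by
  intro h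
  obtain ⟨v, hv, hvr⟩ := (hT j.1).exists_ne hk j.2.2 (r j.1)
  obtain ⟨w, -, hw⟩ : attachMap a r j.1 v ∈ Sum.inl '' s := h ▸ Set.mem_image_of_mem _ hv
  exact hvr (attachMap_eq_inl hw.symm).1

lemma card_attachEdge (hT : ∀ i, (T i).IsUniform k) (j : Σ i, E(T i)) :
    (attachEdge a T r j).Finite ∧ (attachEdge a T r j).ncard = k := by
  obtain ⟨h1, h2⟩ := hT j.1 j.2 j.2.2
  exact ⟨h1.image _, by rw [attachEdge, Set.ncard_image_of_injective _ (attachMap_injective _), h2]⟩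

lemma isUniform_attach {G : Hypergraph α} (hG : G.IsUniform k) (hT : ∀ i, (T i).IsUniform k) :
    (G.attach a T r).IsUniform k := by
  intro e he
  rw [edgeSet_attach] at he
  rcases he with ⟨s, hs, rfl⟩ | ⟨j, rfl⟩
  · obtain ⟨h1, h2⟩ := hG s hs
    exact ⟨h1.image _, by rw [Set.ncard_image_of_injective _ Sum.inl_injective, h2]⟩
  · exact card_attachEdge hT j

lemma IsHypertree.finite_edgeSet {β : Type*} {G : Hypergraph β} (hG : G.IsHypertree k) :
    E(G).Finite :=
  hG.finite.finite_subsets.subset edgeSet_subset_powerset_vertexSet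

lemma finite_sigma_edgeSet [Finite ι] (hT : ∀ i, (T i).IsHypertree k) :
    Finite (Σ i, E(T i)) := by
  have : ∀ i, Finite E(T i) := fun i => (hT i).finite_edgeSet
  infer_instance

lemma ncard_edgeSet_attach [Finite ι] (hk : 2 ≤ k) {G : Hypergraph α} (hG : E(G).Finite)
    (hT : ∀ i, (T i).IsHypertree k) :
    E(G.attach a T r).ncard = E(G).ncard + Nat.card (Σ i, E(T i)) := by
  have := finite_sigma_edgeSet hT
  rw [edgeSet_attach, Set.ncard_union_eq _ (hG.image _) (Set.finite_range _),
    Set.ncard_image_of_injective _ Sum.inl_injective.image_injective,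
    ← Nat.card_coe_set_eq (Set.range _),
    Nat.card_range_of_injective (attachEdge_injective hk fun i => (hT i).uniform)]
  rw [Set.disjoint_left]
  rintro _ ⟨s, -, rfl⟩ ⟨j, hj⟩
  exact image_inl_ne_attachEdge hk (fun i => (hT i).uniform) s j hj.symm

lemma inl_mem_attach {G : Hypergraph α} {b : α} (hb : b ∈ V(G)) :
    Sum.inl b ∈ V(G.attach a T r) :=
  Or.inl ⟨b, hb, rfl⟩

lemma attachMap_mem_attach (G : Hypergraph α) {i : ι} {w : W i} (hw : w ∈ V(T i)) :
    attachMap a r i w ∈ V(G.attach a T r) :=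
  Or.inr (Set.mem_iUnion.2 ⟨i, w, hw, rfl⟩)

lemma finite_attach [Finite ι] {G : Hypergraph α} (hG : V(G).Finite)
    (hT : ∀ i, (T i).IsHypertree k) : V(G.attach a T r).Finite :=
  (hG.image _).union (Set.finite_iUnion fun i => (hT i).finite.image _)

/-- Every vertex of the result of attaching hypergraphs determines a vertex `b` of the base and
roots of the attached hypergraphs, all but at most one of them the original ones. -/
lemma exists_roots {G : Hypergraph α} (hr : ∀ i, r i ∈ V(T i)) {p : α ⊕ (Σ i, W i)}
    (hp : p ∈ V(G.attach a T r)) :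
    ∃ (b : α) (s : ∀ i, W i), (∀ i, s i ∈ V(T i)) ∧
      (∀ i, s i ≠ r i → a i = b ∧ p = attachMap a r i (s i)) ∧
      ((∀ i, s i = r i) → p = Sum.inl b) ∧ ∀ i j, s i ≠ r i → s j ≠ r j → i = j := by
  classical
  rcases p with b | ⟨i, w⟩
  · exact ⟨b, r, hr, fun i h => absurd rfl h, fun _ => rfl, fun i _ h => absurd rfl h⟩
  · obtain ⟨hwV, hwr⟩ : w ∈ V(T i) ∧ w ≠ r i := by
      rcases hp with ⟨c, -, hc⟩ | hp
      · simp at hc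
      · obtain ⟨j, w', hw', h⟩ := Set.mem_iUnion.1 hp
        by_cases h' : w' = r j
        · rw [h', attachMap_root] at h
          simp at h
        · rw [attachMap_of_ne h', Sum.inr.injEq, Sigma.mk.injEq] at h
          obtain ⟨rfl, h⟩ := h
          obtain rfl := eq_of_heq h
          exact ⟨hw', h'⟩
    have hne : ∀ j, Function.update r i w j ≠ r j → j = i := fun j hj => by
      by_contra h
      exact hj (Function.update_of_ne h _ _)
    refine ⟨a i, Function.update r i w, fun j => ?_, fun j hj => ?_, fun h => ?_, fun j j' hj hj' =>
      (hne j hj).trans (hne j' hj').symm⟩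
    · by_cases h : j = i
      · subst h
        rwa [Function.update_self]
      · rw [Function.update_of_ne h]
        exact hr j
    · obtain rfl := hne j hj
      rw [Function.update_self, attachMap_of_ne hwr]
      exact ⟨rfl, rfl⟩
    · have := h i
      rw [Function.update_self] at this
      exact absurd this hwr

lemma isUniform_completeUniform (n : ℕ) {k : ℕ} : (completeUniform n k).IsUniform k :=
  fun e he => ⟨e.toFinite, he⟩

lemma exists_attach_eq_image_rootedModel {n m : ℕ} {ι : Type*} [Finite ι] {W : ι → Type*}
    {a : ι → Fin n} {r : ∀ i, W i} {T : ∀ i, Hypergraph (W i)} (hk : 2 ≤ k)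
    (hT : ∀ i, (T i).IsHypertree k) (hr : ∀ i, r i ∈ V(T i)) (hm : Nat.card (Σ i, E(T i)) = m)
    {p : Fin n ⊕ (Σ i, W i)} (hp : p ∈ V((completeUniform n k).attach a T r)) :
    ∃ (b : Fin n) (c₀ : Fin n ⊕ Fin m × Fin (k - 1)) (q : Fin m → Fin n ⊕ Fin m × Fin (k - 1))
      (ρ : Fin n ⊕ Fin m × Fin (k - 1) → Fin n ⊕ (Σ i, W i)), IsProperModel b c₀ q ∧ ρ.Injective ∧
        ρ (Sum.inl b) = p ∧ (completeUniform n k).attach a T r = (rootedModel b c₀ q).image ρ := by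
  obtain ⟨b, s, hs, hsr, hsb, hsu⟩ := exists_roots hr hp
  have hTu : ∀ i, (T i).IsUniform k := fun i => (hT i).uniform
  have := finite_sigma_edgeSet hT
  -- A tree containing p away from its attaching vertex is rooted at p, every other tree at its
  -- attaching vertex.
  choose par hpar using fun i => (hT i).exists_isRooting (by omega) (hs i)
  have hdiff : ∀ j : Σ i, E(T i), attachEdge a T r j \ {attachMap a r j.1 (par j.1 j.2)} =
      attachMap a r j.1 '' (j.2 \ {par j.1 j.2}) := fun j => by
    rw [attachEdge, Set.image_sdiff (attachMap_injective _), Set.image_singleton]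
  refine ⟨b, exists_eq_image_rootedModel _ hm Sum.inl_injective (attachEdge_injective hk hTu)
    (edgeSet_attach _) (fun s j _ => image_inl_ne_attachEdge hk hTu s j) (card_attachEdge hTu) hp
    (fun b => inl_mem_attach trivial) (a := b) ?_
    (par := fun j => attachMap a r j.1 (par j.1 j.2)) ?_ ?_ ?_⟩
  · intro c hc h
    by_cases hall : ∀ i, s i = r i
    · rw [hsb hall] at h
      exact hc (Sum.inl_injective h)
    · push Not at hall
      obtain ⟨i, hi⟩ := hall
      exact hi (attachMap_eq_inl ((hsr i hi).2.symm.trans h.symm)).1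
  · exact fun j => Set.mem_image_of_mem _ ((hpar j.1).par_mem _ j.2.2)
  · rintro ⟨i, e, he⟩ ⟨j, f, hf⟩ v hv hv'
    rw [hdiff] at hv hv'
    obtain ⟨w, hw, rfl⟩ := hv
    obtain ⟨w', hw', h⟩ := hv'
    simp only at hw hw' h
    by_cases hij : i = j
    · subst hij
      obtain rfl := attachMap_injective i h
      obtain rfl := (hpar i).disjoint e he f hf w' hw hw'
      rfl
    · obtain ⟨rfl, rfl⟩ := attachMap_eq_attachMap hij h.symm
      exact absurd (hsu i j (((hpar i).child_iff _).1 ⟨e, he, hw⟩).2.symm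
        (((hpar j).child_iff _).1 ⟨f, hf, hw'⟩).2.symm) hij
  · intro v
    constructor
    · rintro ⟨⟨i, e, he⟩, hv⟩
      rw [hdiff] at hv
      obtain ⟨w, hw, rfl⟩ := hv
      obtain ⟨hwV, hws⟩ := ((hpar i).child_iff w).1 ⟨e, he, hw⟩
      refine ⟨attachMap_mem_attach _ hwV, fun h => ?_, fun c hc h => ?_⟩
      · by_cases hall : ∀ i, s i = r i
        · rw [hsb hall] at h
          exact hws ((attachMap_eq_inl h).1.trans (hall i).symm)
        · push Not at hall
          obtain ⟨j, hj⟩ := hall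
          simp only at h
          rw [(hsr j hj).2] at h
          by_cases hij : i = j
          · subst hij
            exact hws (attachMap_injective i h)
          · exact hj (attachMap_eq_attachMap hij h).2
      · obtain ⟨rfl, rfl⟩ := attachMap_eq_inl h
        exact hc (hsr i hws.symm).1
    · rintro ⟨hv, hvp, hvc⟩
      suffices ∃ i, ∃ w ∈ V(T i), w ≠ s i ∧ attachMap a r i w = v by
        obtain ⟨i, w, hw, hws, rfl⟩ := this
        obtain ⟨e, he, hwe⟩ := ((hpar i).child_iff w).2 ⟨hw, hws⟩
        refine ⟨⟨i, e, he⟩, ?_⟩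
        rw [hdiff]
        exact Set.mem_image_of_mem _ hwe
      -- The base vertex b, if different from p, is a child in the tree that contains p: it is the
      -- original root of that tree.
      rcases hv with ⟨c, -, rfl⟩ | hv
      · obtain rfl : c = b := by
          by_contra h
          exact hvc c h rfl
        by_cases hall : ∀ i, s i = r i
        · exact absurd (hsb hall).symm hvp
        · push Not at hall
          obtain ⟨i, hi⟩ := hall
          refine ⟨i, r i, hr i, hi.symm, ?_⟩
          rw [attachMap_root, (hsr i hi).1]
      · obtain ⟨i, w, hw, rfl⟩ := Set.mem_iUnion.1 hv
        by_cases hws : w = s i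
        · subst hws
          by_cases hi : s i = r i
          · by_cases hall : ∀ i, s i = r i
            · rw [hi, attachMap_root] at hvp hvc
              by_cases hc : a i = b
              · exact absurd (by rw [hsb hall, hc]) hvp
              · exact absurd rfl (hvc (a i) hc)
            · push Not at hall
              obtain ⟨j, hj⟩ := hall
              rw [hi, attachMap_root] at hvc ⊢
              by_cases hc : a i = b
              · refine ⟨j, r j, hr j, hj.symm, ?_⟩
                rw [attachMap_root, (hsr j hj).1, hc]
              · exact absurd rfl (hvc (a i) hc)
          · exact absurd (hsr i hi).2.symm hvp
        · exact ⟨i, w, hw, hws, rfl⟩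

end Attach

/-! ### The hyperstar and its coalescence with the complete hypergraph -/

section Hyperstar

lemma isHypertree_hyperstar (m : ℕ) {k : ℕ} (hk : 2 ≤ k) : (hyperstar m k).IsHypertree k where
  finite := Set.toFinite _
  uniform := by
    rintro _ ⟨i, rfl⟩
    refine ⟨Set.toFinite _, ?_⟩
    rw [Set.ncard_insert_of_notMem (by simp), ← Nat.card_coe_set_eq, Nat.card_range_of_injective,
      Nat.card_fin]
    · omega
    · intro j j' h
      simpa using h
  connected := by
    have h : ∀ v, Relation.ReflTransGen (hyperstar m k).Adj none v ∧
        Relation.ReflTransGen (hyperstar m k).Adj v none := by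
      rintro (_ | ⟨i, j⟩)
      · exact ⟨.refl, .refl⟩
      · have hadj : (hyperstar m k).Adj none (some (i, j)) :=
          ⟨_, ⟨i, rfl⟩, Set.mem_insert _ _, Set.mem_insert_of_mem _ ⟨j, rfl⟩⟩
        exact ⟨.single hadj, .single hadj.symm⟩
    exact ⟨⟨none, trivial⟩, fun u _ v _ => (h u).2.trans (h v).1⟩
  acyclic := by
    rintro ⟨l, v, e, hv, he, h⟩
    -- Two different edges of the star share only the center, so all vertices of a cycle would
    -- coincide.
    have hnone : ∀ i, v (i + 1) = none := by
      intro i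
      by_contra hne
      obtain ⟨x, hx⟩ := Option.ne_none_iff_exists'.1 hne
      obtain ⟨⟨j, hj⟩, -, h1⟩ := h i
      obtain ⟨⟨j', hj'⟩, h2, -⟩ := h (i + 1)
      rw [hx, ← hj] at h1
      rw [hx, ← hj'] at h2
      simp only [Set.mem_insert_iff, reduceCtorEq, Set.mem_range, Option.some.injEq, false_or]
        at h1 h2
      obtain ⟨t, rfl⟩ := h1
      obtain ⟨t', h2⟩ := h2
      obtain rfl : j' = j := (Prod.ext_iff.1 h2).1
      have := he (hj.symm.trans hj')
      simp at this
    have := hv ((hnone 0).trans (hnone 1).symm)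
    simp at this

lemma card_edgeSet_hyperstar (m : ℕ) {k : ℕ} (hk : 2 ≤ k) :
    Nat.card E(hyperstar m k) = m := by
  change Nat.card (Set.range _) = m
  rw [Nat.card_range_of_injective, Nat.card_fin]
  intro i j h
  have : some (i, (⟨0, by omega⟩ : Fin (k - 1))) ∈
      insert none (Set.range fun l : Fin (k - 1) => some (i, l)) :=
    Set.mem_insert_of_mem _ ⟨_, rfl⟩
  simp only at h
  rw [h] at this
  simp only [Set.mem_insert_iff, reduceCtorEq, Set.mem_range, Option.some.injEq, Prod.mk.injEq,
    false_or] at this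
  obtain ⟨_, rfl, _⟩ := this
  rfl

variable {n m k : ℕ}

lemma attachClass_coalescence_hyperstar (hk : 2 ≤ k) (u : Fin n) :
    AttachClass k m (completeUniform n k) _
      ((completeUniform n k).coalescence u (hyperstar m k) none) := by
  refine ⟨⟨Unit, inferInstance, _, _, _, _, fun _ => trivial,
    fun _ => isHypertree_hyperstar m hk, fun _ => trivial, Isomorphic.refl _⟩, ?_⟩
  rw [coalescence, ncard_edgeSet_attach hk (Set.toFinite _) fun _ => isHypertree_hyperstar m hk,
    Nat.card_sigma]
  simp [card_edgeSet_hyperstar m hk]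

/-- The coalescence of a complete uniform hypergraph with a hyperstar, as a rooted model. -/
def starModel (n m k : ℕ) (u : Fin n) : Hypergraph (Fin n ⊕ Fin m × Fin (k - 1)) :=
  rootedModel u (Sum.inl u) fun _ => Sum.inl u

lemma isProperModel_star (hk : 2 ≤ k) (u : Fin n) :
    IsProperModel (m := m) (k := k) u (Sum.inl u) fun _ => Sum.inl u := by
  have h0 : Function.update Sum.inl u (Sum.inl u) = (Sum.inl : Fin n → Fin n ⊕ Fin m × Fin (k - 1)) :=
    Function.update_eq_self _ _
  have hmem : ∀ i : Fin m, Sum.inr (i, (⟨0, by omega⟩ : Fin (k - 1))) ∈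
      (insert (Sum.inl u) (Set.range fun l => Sum.inr (i, l)) :
        Set (Fin n ⊕ Fin m × Fin (k - 1))) := fun i =>
    Set.mem_insert_of_mem _ ⟨_, rfl⟩
  refine ⟨by rw [h0]; exact Sum.inl_injective, by simp, fun i j h => ?_, fun s j _ h => ?_⟩
  · have := hmem i
    simp only at h
    rw [h] at this
    simp only [Set.mem_insert_iff, reduceCtorEq, Set.mem_range, Sum.inr.injEq, Prod.mk.injEq,
      false_or] at this
    obtain ⟨_, rfl, _⟩ := this
    rfl
  · have := hmem j
    rw [← h, h0] at this
    simp at this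

/-- The transposition of u and v is an automorphism of the complete hypergraph. -/
lemma isomorphic_starModel (u v : Fin n) :
    (starModel n m k u).Isomorphic (starModel n m k v) := by
  let σ : Fin n ⊕ Fin m × Fin (k - 1) → Fin n ⊕ Fin m × Fin (k - 1) :=
    Sum.map (Equiv.swap u v) id
  have hσ : σ.Injective := (Equiv.swap u v).injective.sumMap Function.injective_id
  have : starModel n m k v = (starModel n m k u).image σ := by
    apply Hypergraph.ext
    · exact (Set.image_univ_of_surjective
        ((Equiv.swap u v).surjective.sumMap Function.surjective_id)).symm
    · simp only [image_edgeSet, starModel, rootedModel, Function.update_eq_self, Set.image_union]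
      congr 1
      · ext e
        constructor
        · rintro ⟨s, hs, rfl⟩
          refine ⟨_, ⟨Equiv.swap u v '' s, ?_, rfl⟩, ?_⟩
          · rwa [Set.mem_ofPred_eq, Set.ncard_image_of_injective _ (Equiv.injective _)]
          · simp [Set.image_image, σ]
        · rintro ⟨_, ⟨s, hs, rfl⟩, rfl⟩
          refine ⟨Equiv.swap u v '' s, ?_, ?_⟩
          · rwa [Set.mem_ofPred_eq, Set.ncard_image_of_injective _ (Equiv.injective _)]
          · simp [Set.image_image, σ]
      · rw [← Set.range_comp]
        congr 1
        funext j
        simp [σ, Set.image_insert_eq, ← Set.range_comp, Function.comp_def]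
  rw [this]
  exact isomorphic_image _ hσ

lemma starModel_isomorphic_coalescence (u : Fin n) : (starModel n m k u).Isomorphic
    ((completeUniform n k).coalescence u (hyperstar m k) none) := by
  let ρ : Fin n ⊕ Fin m × Fin (k - 1) → Fin n ⊕ (Σ _ : Unit, Option (Fin m × Fin (k - 1))) :=
    Sum.map id fun t => ⟨(), some t⟩
  have hρ : ρ.Injective := Function.injective_id.sumMap fun s t h => by simpa using h
  have : (completeUniform n k).coalescence u (hyperstar m k) none =
      (starModel n m k u).image ρ := by
    apply Hypergraph.ext
    · ext v
      simp only [coalescence, attach, image_vertexSet, starModel, rootedModel, completeUniform,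
        hyperstar, Set.image_univ, Set.mem_union, Set.mem_range, Set.mem_iUnion]
      constructor
      · rintro (⟨b, rfl⟩ | ⟨⟨⟩, _ | t, rfl⟩)
        · exact ⟨Sum.inl b, rfl⟩
        · exact ⟨Sum.inl u, (attachMap_root (a := fun _ : Unit => u)
            (r := fun _ => (none : Option (Fin m × Fin (k - 1)))) ()).symm⟩
        · exact ⟨Sum.inr t, (attachMap_of_ne (by simp)).symm⟩
      · rintro ⟨b | t, rfl⟩
        · exact Or.inl ⟨b, rfl⟩
        · exact Or.inr ⟨(), some t, attachMap_of_ne (by simp)⟩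
    · rw [coalescence, edgeSet_attach, image_edgeSet]
      simp only [starModel, rootedModel, Function.update_eq_self, Set.image_union]
      congr 1
      · rw [Set.image_image]
        refine Set.image_congr fun s _ => ?_
        rw [← Set.image_comp]
        rfl
      · have hedge : ∀ i : Fin m, attachMap (fun _ : Unit => u)
            (fun _ => (none : Option (Fin m × Fin (k - 1)))) () ''
              insert none (Set.range fun l : Fin (k - 1) => some (i, l)) =
            ρ '' insert (Sum.inl u) (Set.range fun l => Sum.inr (i, l)) := fun i => by
          rw [Set.image_insert_eq, Set.image_insert_eq, attachMap_root (a := fun _ : Unit => u)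
            (r := fun _ => (none : Option (Fin m × Fin (k - 1)))) (), ← Set.range_comp,
            ← Set.range_comp]
          congr 2
          funext l
          exact attachMap_of_ne (by simp)
        ext e
        constructor
        · rintro ⟨⟨⟨⟩, _, ⟨i, rfl⟩⟩, rfl⟩
          exact ⟨_, ⟨i, rfl⟩, (hedge i).symm⟩
        · rintro ⟨_, ⟨i, rfl⟩, rfl⟩
          exact ⟨⟨(), _, ⟨i, rfl⟩⟩, hedge i⟩
  rw [this]
  exact isomorphic_image _ hρ

end Hyperstar

/-! ### Comparison of a member of the class with the star coalescence -/

section Comparison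

open Finset

variable {n m k : ℕ}

/-- With μ = -ν the energy is the edge form minus ν times the power sum. -/
lemma starEnergy_nonneg (hk : 2 ≤ k) {a : Fin n} {ν : ℝ}
    {β : Type*} {H : Hypergraph β} [Fintype V(H)] (hH : H.Isomorphic (starModel n m k a))
    (hν : IsLeastQuotient k (edgeForm H.edgeFinsets) ν) (z : Fin n → ℝ)
    (c : Fin m → Fin (k - 1) → ℝ) : 0 ≤ starEnergy (k - 1) (-ν) a z c := by
  classical
  have : Fintype V((rootedModel a (Sum.inl a) fun _ : Fin m => (Sum.inl a :
      Fin n ⊕ Fin m × Fin (k - 1))).image id) := Fintype.ofFinite _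
  have hiso : H.Isomorphic ((rootedModel a (Sum.inl a) fun _ : Fin m => (Sum.inl a :
      Fin n ⊕ Fin m × Fin (k - 1))).image id) :=
    hH.trans (isomorphic_image _ Function.injective_id)
  have h1 := (hiso.isLeastQuotient hν).1
  let y : Fin n ⊕ Fin m × Fin (k - 1) → ℝ := Sum.elim z fun t => c t.1 t.2
  have h2 := h1 fun v => y v
  rw [sum_pow_image_rootedModel Function.injective_id _ (y := y) fun _ => rfl,
    edgeForm_image_rootedModel (isProperModel_star hk a) Function.injective_id _ (y := y)
      fun _ => rfl] at h2
  simp only [y, Sum.elim_inl, Sum.elim_inr, Function.update_eq_self] at h2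
  rw [starEnergy, mul_sum, Nat.sub_add_cancel (by omega)]
  linarith

/-- The least quotient of a hypergraph obtained from the complete uniform hypergraph by attaching
hypertrees is at least that of the coalescence with a hyperstar, with equality only for the
latter. -/
lemma le_and_isomorphic_of_eq (hk : 2 ≤ k) (hke : Even k) (hn : k + 1 ≤ n) {ι : Type*} [Finite ι]
    {W : ι → Type*} {a : ι → Fin n} {r : ∀ i, W i} {T : ∀ i, Hypergraph (W i)}
    (hT : ∀ i, (T i).IsHypertree k) (hr : ∀ i, r i ∈ V(T i)) (hm : Nat.card (Σ i, E(T i)) = m)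
    [Fintype V((completeUniform n k).attach a T r)] {ν ν' : ℝ}
    (hν : IsLeastQuotient k (edgeForm ((completeUniform n k).attach a T r).edgeFinsets) ν)
    {β : Type*} {H : Hypergraph β} [Fintype V(H)] {u : Fin n}
    (hH : H.Isomorphic (starModel n m k u))
    (hν' : IsLeastQuotient k (edgeForm H.edgeFinsets) ν') :
    ν' ≤ ν ∧ (ν' = ν → ((completeUniform n k).attach a T r).Isomorphic (starModel n m k u)) := by
  classical
  obtain ⟨-, x, hx0, hx⟩ := hν
  have hne : Nonempty V((completeUniform n k).attach a T r) := by
    by_contra h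
    rw [not_nonempty_iff] at h
    exact hx0 (Subsingleton.elim _ _)
  obtain ⟨p, hp⟩ := Finite.exists_max fun v => |x v|
  obtain ⟨b, c₀, q, ρ, hM, hρ, hρb, heq⟩ := exists_attach_eq_image_rootedModel hk hT hr hm p.2
  generalize (completeUniform n k).attach a T r = K at *
  subst heq
  let y : Fin n ⊕ Fin m × Fin (k - 1) → ℝ := fun i => x ⟨ρ i, i, trivial, rfl⟩
  have hyb : y (Sum.inl b) = x p := congrArg x (Subtype.ext hρb)
  have hmax : ∀ i, |y i| ≤ |y (Sum.inl b)| := fun i => by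
    rw [hyb]
    exact hp _
  have hpos := sum_pow_pos hke hx0
  have hyb0 : y (Sum.inl b) ≠ 0 := by
    intro h0
    refine hx0 (funext fun v => ?_)
    have := hp v
    rw [← hyb, h0, abs_zero] at this
    exact abs_nonpos_iff.1 this
  have hk1 : k - 1 + 1 = k := Nat.sub_add_cancel (by omega)
  have hstar := starEnergy_nonneg hk (hH.trans (isomorphic_starModel u b)) hν'
  have hnL : Nonempty (Fin (k - 1)) := ⟨⟨0, by omega⟩⟩
  have hupd := elemSymm_update b (k - 1) (fun b => y (Sum.inl b)) (y c₀)
  rw [hk1] at hupd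
  obtain ⟨hW, hW'⟩ := energy_nonneg_and_of_eq_zero (d := k - 1) (L := Fin (k - 1)) (by simp)
    (by rwa [hk1]) (by rw [hk1, Fintype.card_fin]; omega) hstar
    (z := fun b => y (Sum.inl b)) (c := fun j l => y (Sum.inr (j, l))) (hmax c₀)
    (fun j => hmax (q j)) (W := edgeForm ((rootedModel b c₀ q).image ρ).edgeFinsets x +
      -ν' * ∑ v, x v ^ k) (by
        rw [edgeForm_image_rootedModel hM hρ x (y := y) fun _ => rfl,
          sum_pow_image_rootedModel hρ x (y := y) fun _ => rfl, hupd, hk1])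
  rw [hx] at hW hW'
  refine ⟨le_of_mul_le_mul_right (by linarith) hpos, fun h => ?_⟩
  subst h
  obtain ⟨h1, h2, h3⟩ := hW' (by ring) hyb0
  have hlt : ∀ j l, |y (Sum.inr (j, l))| < |y (Sum.inl b)| := fun j => (h3 ⟨j⟩).1 j
  -- Another base vertex is excluded by injectivity alone. The strict inequality is needed only
  -- against a child, whose existence provides a star edge, so m = 0 is covered.
  have hc₀ : c₀ = Sum.inl b := by
    rcases c₀ with c | ⟨j, l⟩
    · by_contra h
      have hcb : c ≠ b := fun h' => h (h' ▸ rfl)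
      refine hcb (hM.injective_base ?_)
      rw [Function.update_of_ne hcb, Function.update_self]
    · exact absurd h1 (hlt j l).ne
  have hq : ∀ j, q j = Sum.inl b := by
    intro j
    have h2j := h2 j
    generalize q j = v at h2j
    rcases v with c | ⟨i, l⟩
    · by_contra h
      exact (h3 ⟨j⟩).2 c (fun h' => h (h' ▸ rfl)) h2j
    · exact absurd h2j (hlt i l).ne
  obtain rfl : q = fun _ => Sum.inl b := funext hq
  subst hc₀
  exact (isomorphic_image _ hρ).symm.trans (isomorphic_starModel b u)

end Comparison

lemma AttachClass.isUniform {k m n : ℕ} {γ : Type} {G : Hypergraph γ}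
    (h : AttachClass k m (completeUniform n k) γ G) : G.IsUniform k := by
  obtain ⟨⟨ι, _, W, a, T, r, -, hT, -, hiso⟩, -⟩ := h
  exact hiso.symm.isUniform (isUniform_attach (isUniform_completeUniform n) fun i => (hT i).uniform)

lemma AttachClass.nonempty {k m n : ℕ} (hn : n ≠ 0) {γ : Type} {G : Hypergraph γ}
    (h : AttachClass k m (completeUniform n k) γ G) : V(G).Nonempty := by
  obtain ⟨⟨ι, _, W, a, T, r, -, -, -, hiso⟩, -⟩ := h
  exact hiso.symm.nonempty ⟨Sum.inl ⟨0, Nat.pos_of_ne_zero hn⟩, inl_mem_attach trivial⟩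

lemma AttachClass.congr {k m : ℕ} {α : Type*} {G₀ : Hypergraph α} {γ δ : Type}
    {G : Hypergraph γ} {H : Hypergraph δ} (h : AttachClass k m G₀ γ G) (hGH : H.Isomorphic G) :
    AttachClass k m G₀ δ H := by
  obtain ⟨⟨ι, hι, W, a, T, r, ha, hT, hr, hiso⟩, hcard⟩ := h
  exact ⟨⟨ι, hι, W, a, T, r, ha, hT, hr, hGH.trans hiso⟩, by rw [hGH.ncard_edgeSet_eq, hcard]⟩

/-- The coalescence with a hyperstar has the least eigenvalue in the class, and is the only member
of the class with that eigenvalue. -/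
lemma AttachClass.leastHEigenvalue_le_and_isomorphic {k m n : ℕ} (hk : 2 ≤ k) (hke : Even k)
    (hn : k + 1 ≤ n) {γ : Type} {G : Hypergraph γ} [Fintype V(G)]
    (h : AttachClass k m (completeUniform n k) γ G) (u : Fin n) {δ : Type} {H : Hypergraph δ}
    [Fintype V(H)] (hH : H.Isomorphic ((completeUniform n k).coalescence u (hyperstar m k) none)) :
    H.leastHEigenvalue k ≤ G.leastHEigenvalue k ∧
      (H.leastHEigenvalue k = G.leastHEigenvalue k → G.Isomorphic
        ((completeUniform n k).coalescence u (hyperstar m k) none)) := by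
  have hk0 : k ≠ 0 := by omega
  have hHc := (attachClass_coalescence_hyperstar hk u).congr (m := m) hH
  have hνG := h.isUniform.isLeastQuotient hk0 hke (h.nonempty (by omega))
  have hνH := hHc.isUniform.isLeastQuotient hk0 hke (hHc.nonempty (by omega))
  obtain ⟨⟨ι, _, W, a, T, r, -, hT, hr, hiso⟩, hcard⟩ := h
  have : Fintype V((completeUniform n k).attach a T r) :=
    (finite_attach (Set.toFinite _) hT).fintype
  rw [hiso.ncard_edgeSet_eq, ncard_edgeSet_attach hk (Set.toFinite _) hT] at hcard
  obtain ⟨h1, h2⟩ := le_and_isomorphic_of_eq hk hke hn hT hr (by omega) (hiso.isLeastQuotient hνG)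
    (hH.trans (starModel_isomorphic_coalescence u).symm) hνH
  have hk' : (0 : ℝ) < k := by positivity
  refine ⟨(div_le_div_iff_of_pos_right hk').1 h1, fun heq => ?_⟩
  exact hiso.trans ((h2 (by rw [heq])).trans (starModel_isomorphic_coalescence u))

end Hypergraph

theorem corollary4p5 (k n m : ℕ) (hk : 2 ≤ k) (hke : Even k) (hn : k + 1 ≤ n) :
    -- the least H-eigenvalue is attained for every member of the class
    (∀ (γ : Type) (G : Hypergraph γ) [Fintype V(G)],
      Hypergraph.AttachClass k m (Hypergraph.completeUniform n k) γ G →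
        IsLeast (G.hEigenvalues k) (G.leastHEigenvalue k)) ∧
    -- the minimizing hypergraphs are exactly the isomorphic copies of the coalescence
    ∀ (u : Fin n) (γ : Type) (G : Hypergraph γ) [Fintype V(G)],
      G.IsMinimizing k (Hypergraph.AttachClass k m (Hypergraph.completeUniform n k)) ↔
        G.Isomorphic
          ((Hypergraph.completeUniform n k).coalescence u (Hypergraph.hyperstar m k) none) := by
  refine ⟨fun γ G _ h => h.isUniform.isLeast_leastHEigenvalue (by omega) hke
    (h.nonempty (by omega)), fun u γ G _ => ⟨fun h => ?_, fun h => ⟨?_, fun δ H _ hH => ?_⟩⟩⟩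
  · have hc := Hypergraph.attachClass_coalescence_hyperstar (m := m) hk u
    have : Fintype V((Hypergraph.completeUniform n k).coalescence u
        (Hypergraph.hyperstar m k) none) :=
      (Hypergraph.finite_attach (Set.toFinite _) fun _ =>
        Hypergraph.isHypertree_hyperstar m hk).fintype
    obtain ⟨h1, h2⟩ := h.1.leastHEigenvalue_le_and_isomorphic hk hke hn u
      (Hypergraph.Isomorphic.refl _)
    exact h2 (le_antisymm h1 (h.2 _ _ hc))
  · exact (Hypergraph.attachClass_coalescence_hyperstar hk u).congr h
  · exact (hH.leastHEigenvalue_le_and_isomorphic hk hke hn u h).1
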